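/- Let $G=(V,A)$ be a finite directed acyclic graph whose $n=|V|$ vertices are called items. An item $u$ dominates an item $v$ if $G$ has a directed path, possibly of length $0$, from $u$ to $v$. The width of $G$ is the largest cardinality of a set of vertices no two of which are joined by a directed path in either direction. An allocation $\pi$ of the items to a set $K=\{1,\dots,k\}$ of agents assigns pairwise disjoint sets $\pi(1),\dots,\pi(k)\subseteq V$ to the agents (items may remain unallocated, and agents may receive nothing). The dissatisfaction $\delta_\pi(i)$ of agent $i$ is the number of items in $V$ that are not dominated by any item of $\pi(i)$. The problem CG Min-Sum Dissatisfaction asks, given $G$, $k$ and an integer $d$, whether there is an allocation $\pi$ with $\sum_{i\in K}\delta_\pi(i)\le d$. **Theorem 3.5.** For any number $k$ of agents, CG Min-Sum Dissatisfaction is solvable in polynomial time if the preference graph $G$ has width at most $2$, and an optimal allocation can be found in polynomial time as well. Precisely: there are a single random access program and a polynomial $p$ such that for every finite directed acyclic graph $G$ with $n$ vertices and width at most $2$, every integer $k\ge 0$ and every integer $d$, the program, given $n$, $k$, $d$ and the adjacency matrix of $G$, halts after at most $p(n)$ steps, having computed the correct yes/no answer for $(G,k,d)$ together with an allocation $\pi$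 that minimizes $\sum_{i\in K}\delta_\pi(i)$, written as the list that gives for each item the agent who receives it or $0$ if the item is unallocated. Here a random access program works on integer memory cells arranged in arrays, by assignments, if-branching and while-loops over expressions that use constants, memory access with computed indices, addition, subtraction and comparison; each such operation counts as one step. (There is no multiplication, so polynomially many steps in this model amount to polynomial time on a Turing machine.) -/

import Mathlib

namespace CGMinSum

/-! ### Preference graphs, allocations, dissatisfaction -/

section Graphs

variable {V : Type*}

/-- There is a directed path, possibly of length `0`, from `u` to `v`: item `u` dominates `v`. -/
def Dominates (G : Digraph V) (u v : V) : Prop :=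
  Relation.ReflTransGen G.Adj u v

/-- No closed walk of positive length. -/
def Acyclic (G : Digraph V) : Prop :=
  ∀ v, ¬ Relation.TransGen G.Adj v v

open Classical in
/-- The maximum cardinality of an antichain, i.e. of a set of vertices that are pairwise
unreachable from each other. -/
noncomputable def width [Fintype V] (G : Digraph V) : ℕ :=
  (Finset.univ.filter fun S : Finset V => IsAntichain (Dominates G) (S : Set V)).sup Finset.card

/-- An allocation of items to `k` agents: pairwise disjoint sets of items.
Items may stay unallocated and agents may receive nothing. -/
structure Allocation (V : Type*) (k : ℕ) where
  bundle : Fin k → Finset V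
  disjoint : ∀ i j, i ≠ j → Disjoint (bundle i) (bundle j)

open Classical in
/-- The number of items that are not dominated by any item that agent `i` receives. -/
noncomputable def dissatisfaction [Fintype V] {k : ℕ} (G : Digraph V) (π : Allocation V k)
    (i : Fin k) : ℕ :=
  (Finset.univ.filter fun v : V => ¬ ∃ u ∈ π.bundle i, Dominates G u v).card

noncomputable def totalDissatisfaction [Fintype V] {k : ℕ} (G : Digraph V)
    (π : Allocation V k) : ℕ :=
  ∑ i, dissatisfaction G π i

/-- `π` minimizes the total dissatisfaction. -/
def IsOptimal [Fintype V] {k : ℕ} (G : Digraph V) (π : Allocation V k) : Prop :=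
  ∀ π' : Allocation V k, totalDissatisfaction G π ≤ totalDissatisfaction G π'

end Graphs

/-- An instance of the problem: a directed acyclic graph on the `n` items, a number `k` of
agents, and an integer target `d`. -/
structure Problem where
  n : ℕ
  k : ℕ
  G : Digraph (Fin n)
  acyclic : Acyclic G
  d : ℤ

/-- The question of the decision problem. -/
def Problem.IsYes (I : Problem) : Prop :=
  ∃ π : Allocation (Fin I.n) I.k, (totalDissatisfaction I.G π : ℤ) ≤ I.d

/-! ### Random access programs

The memory consists of integer cells, grouped into statically named two-dimensional arrays.
A program is built from assignments, branching and loops; its expressions use integer constants,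
memory access (with computed indices), addition, subtraction and comparison. Every operation
costs one step. As there is no multiplication, a number held after `t` steps has at most `t` more
bits than the numbers in the input and in the program, so that polynomially many steps of this
model are polynomial time in the usual sense (a Turing machine simulates them in time polynomial
in the number of steps and the length of the input in binary). -/

/-- `s a i j` is the content of cell `(i, j)` of array `a`. -/
abbrev Memory := ℕ → ℤ → ℤ → ℤ

def Memory.set (s : Memory) (a : ℕ) (i j x : ℤ) : Memory :=
  fun a' i' j' => if a' = a ∧ i' = i ∧ j' = j then x else s a' i' j'

inductive Expr where
  | const (c : ℤ)
  | get (a : ℕ) (i j : Expr)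
  | add (e f : Expr)
  | sub (e f : Expr)
  | lt (e f : Expr)

def Expr.eval (s : Memory) : Expr → ℤ
  | .const c => c
  | .get a i j => s a (i.eval s) (j.eval s)
  | .add e f => e.eval s + f.eval s
  | .sub e f => e.eval s - f.eval s
  | .lt e f => if e.eval s < f.eval s then 1 else 0

/-- The number of operations in the evaluation of an expression. -/
def Expr.cost : Expr → ℕ
  | .const _ => 1
  | .get _ i j => i.cost + j.cost + 1
  | .add e f => e.cost + f.cost + 1
  | .sub e f => e.cost + f.cost + 1
  | .lt e f => e.cost + f.cost + 1

inductive Program where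
  | skip
  | assign (a : ℕ) (i j e : Expr)
  | seq (P Q : Program)
  | ite (e : Expr) (P Q : Program)
  | loop (e : Expr) (P : Program)

/-- `Run P s t s'`: started in memory `s`, the program `P` halts after exactly `t` steps, in
memory `s'`. Tests succeed when their value is not `0`; `loop e P` repeats `P` while `e` does. -/
inductive Run : Program → Memory → ℕ → Memory → Prop where
  | skip (s : Memory) : Run .skip s 1 s
  | assign (s : Memory) (a : ℕ) (i j e : Expr) :
      Run (.assign a i j e) s (i.cost + j.cost + e.cost + 1)
        (s.set a (i.eval s) (j.eval s) (e.eval s))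
  | seq {P Q : Program} {s₀ s₁ s₂ : Memory} {t₁ t₂ : ℕ} :
      Run P s₀ t₁ s₁ → Run Q s₁ t₂ s₂ → Run (.seq P Q) s₀ (t₁ + t₂) s₂
  | ite_true {e : Expr} {P Q : Program} {s s' : Memory} {t : ℕ} :
      e.eval s ≠ 0 → Run P s t s' → Run (.ite e P Q) s (e.cost + 1 + t) s'
  | ite_false {e : Expr} {P Q : Program} {s s' : Memory} {t : ℕ} :
      e.eval s = 0 → Run Q s t s' → Run (.ite e P Q) s (e.cost + 1 + t) s'
  | loop_done {e : Expr} {P : Program} {s : Memory} :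
      e.eval s = 0 → Run (.loop e P) s (e.cost + 1) s
  | loop_step {e : Expr} {P : Program} {s₀ s₁ s₂ : Memory} {t₁ t₂ : ℕ} :
      e.eval s₀ ≠ 0 → Run P s₀ t₁ s₁ → Run (.loop e P) s₁ t₂ s₂ →
        Run (.loop e P) s₀ (e.cost + 1 + t₁ + t₂) s₂

/-! ### Input and output conventions -/

open Classical in
/-- The initial memory: array `0` holds `n`, `k`, `d` in its first three cells, array `1` holds
the `0`-`1` adjacency matrix of the graph; all other cells are `0`. -/
noncomputable def Problem.input (I : Problem) : Memory := fun a i j =>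
  if a = 0 ∧ i = 0 ∧ j = 0 then (I.n : ℤ)
  else if a = 0 ∧ i = 0 ∧ j = 1 then (I.k : ℤ)
  else if a = 0 ∧ i = 0 ∧ j = 2 then I.d
  else if a = 1 ∧ ∃ u v : Fin I.n, (u : ℤ) = i ∧ (v : ℤ) = j ∧ I.G.Adj u v then 1
  else 0

/-- The final memory holds the answer to the decision problem in the first cell of array `2`:
`1` for yes and `0` for no. -/
def Problem.AnswerIn (I : Problem) (s : Memory) : Prop :=
  (I.IsYes ∧ s 2 0 0 = 1) ∨ (¬ I.IsYes ∧ s 2 0 0 = 0)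

/-- The first `n` cells of array `3` hold the labeling of the items given by `π`, with the
agents numbered `1, …, k`: the number of the agent who receives the item, and `0` for an
unallocated item. -/
def Problem.LabelingIn (I : Problem) (π : Allocation (Fin I.n) I.k) (s : Memory) : Prop :=
  ∀ v : Fin I.n,
    (∃ i : Fin I.k, v ∈ π.bundle i ∧ s 3 (v : ℤ) 0 = (i : ℤ) + 1) ∨
      ((∀ i : Fin I.k, v ∉ π.bundle i) ∧ s 3 (v : ℤ) 0 = 0)

end CGMinSum

namespace CGMinSum

/-! ### Reasoning about random access programs -/

/-! Minimizing total dissatisfaction is maximizing the total number of dominated items: agent `i`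
contributes `n` minus the size of the down-set generated by the bundle, so the sum is `n * k` minus
the total coverage (`totalDissatisfaction_eq`).

Width at most two means that every nonempty set of items has two maximal members `p`, `q`, possibly
equal, that together dominate it (`exists_two_tops`). Take the two tops of all allocated items. If
one bundle contains both, or one of them dominates the whole bundle it lies in, that bundle can be
peeled off as a pair of tops. Otherwise `p` and `q` lie in different bundles, and these can be
exchanged for `{p, q}` and the rest of their items without losing coverage (`card_below_uncross`).
After peeling, the remaining items lie in the down-set of their own two tops, and maximality and
disjointness keep `p` and `q` out of it (`sum_card_below_le_of_peel`). Hence a dynamic program over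
the number of bundles and a down-set generated by at most two items bounds every allocation
(`sum_card_below_le`).

Adjoining a bottom and a top item makes every state a pair of extended items, so there are `(n + 2)
* (n + 2)` states; at most `n` bundles are nonempty, so `min n k` rows suffice. Following the
recorded choices back from the pair of two top items yields a labeling whose coverage is at least
the table value (`Entry.traverse`). The two bounds meet, which gives both the optimal allocation and
the decision.

The remaining work is a small program logic: `Halts` bounds time and states a postcondition, and
`Halts.count` handles counting loops, the only loops used. All loops are bounded in terms of `n`
alone, whence the polynomial. -/

/-- The scalar variable stored in the cell `(0, 0)` of the array `a`. -/
def Expr.var (a : ℕ) : Expr := .get a (.const 0) (.const 0)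

/-- The arrays to which a program may write. -/
def Program.writes : Program → List ℕ
  | .skip => []
  | .assign a _ _ _ => [a]
  | .seq P Q => P.writes ++ Q.writes
  | .ite _ P Q => P.writes ++ Q.writes
  | .loop _ P => P.writes

theorem Memory.set_of_ne (s : Memory) {a b : ℕ} (i j x : ℤ) (h : b ≠ a) :
    s.set a i j x b = s b := by
  funext i' j'
  simp [Memory.set, h]

theorem Memory.set_same (s : Memory) (a : ℕ) (i j x i' j' : ℤ) :
    s.set a i j x a i' j' = if i' = i ∧ j' = j then x else s a i' j' := by
  simp [Memory.set]

/-- The write set is a computable list, so later claims that an array is untouched reduce to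
`decide` on array numbers. -/
theorem Run.frame {P : Program} {s s' : Memory} {t : ℕ} (h : Run P s t s') :
    ∀ a, a ∉ P.writes → s' a = s a := by
  induction h with
  | skip s => intros; rfl
  | assign s a i j e =>
    intro b hb
    exact Memory.set_of_ne _ _ _ _ (by simpa [Program.writes] using hb)
  | seq _ _ ih₁ ih₂ =>
    intro b hb
    simp only [Program.writes, List.mem_append, not_or] at hb
    rw [ih₂ b hb.2, ih₁ b hb.1]
  | ite_true _ _ ih =>
    intro b hb
    simp only [Program.writes, List.mem_append, not_or] at hb
    exact ih b hb.1
  | ite_false _ _ ih =>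
    intro b hb
    simp only [Program.writes, List.mem_append, not_or] at hb
    exact ih b hb.2
  | loop_done _ => intros; rfl
  | loop_step _ _ _ ih₁ ih₂ =>
    intro b hb
    rw [ih₂ b hb, ih₁ b hb]

/-- Started in `s`, the program `P` halts within `T` steps, in a memory that satisfies `Q`. -/
def Halts (P : Program) (s : Memory) (T : ℕ) (Q : Memory → Prop) : Prop :=
  ∃ t s', Run P s t s' ∧ t ≤ T ∧ Q s'

/-- `s'` agrees with `s` on all arrays that are not in the list `W`. -/
def Frame (W : List ℕ) (s s' : Memory) : Prop :=
  ∀ a, a ∉ W → s' a = s a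

theorem Halts.mono {P : Program} {s : Memory} {T T' : ℕ} {Q Q' : Memory → Prop}
    (h : Halts P s T Q) (hT : T ≤ T') (hQ : ∀ s', Q s' → Frame P.writes s s' → Q' s') :
    Halts P s T' Q' := by
  obtain ⟨t, s', hr, ht, hq⟩ := h
  exact ⟨t, s', hr, ht.trans hT, hQ s' hq hr.frame⟩

theorem Halts.seq {P P' : Program} {s : Memory} {T T' : ℕ} {R Q : Memory → Prop}
    (h : Halts P s T R) (h' : ∀ s', R s' → Frame P.writes s s' → Halts P' s' T' Q) :
    Halts (.seq P P') s (T + T') Q := by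
  obtain ⟨t, s', hr, ht, hq⟩ := h
  obtain ⟨t', s'', hr', ht', hq'⟩ := h' s' hq hr.frame
  exact ⟨t + t', s'', .seq hr hr', add_le_add ht ht', hq'⟩

theorem Halts.ite {e : Expr} {P P' : Program} {s : Memory} {T T' : ℕ} {Q : Memory → Prop}
    (hT : e.cost + 1 + T ≤ T') (h : e.eval s ≠ 0 → Halts P s T Q)
    (h' : e.eval s = 0 → Halts P' s T Q) : Halts (.ite e P P') s T' Q := by
  by_cases he : e.eval s = 0
  · obtain ⟨t, s', hr, ht, hq⟩ := h' he
    exact ⟨_, s', .ite_false he hr, by omega, hq⟩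
  · obtain ⟨t, s', hr, ht, hq⟩ := h he
    exact ⟨_, s', .ite_true he hr, by omega, hq⟩

/-- Whether a program contains neither branches nor loops. -/
def Program.straightLine : Program → Bool
  | .skip => true
  | .assign _ _ _ _ => true
  | .seq P Q => P.straightLine && Q.straightLine
  | .ite _ _ _ => false
  | .loop _ _ => false

/-- The memory in which a straight-line program halts. -/
def Program.den : Program → Memory → Memory
  | .skip, s => s
  | .assign a i j e, s => s.set a (i.eval s) (j.eval s) (e.eval s)
  | .seq P Q, s => Q.den (P.den s)
  -- Junk values for branches and loops; `Halts.of_den` demands `straightLine`.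
  | .ite _ _ _, s => s
  | .loop _ _, s => s

/-- A bound for the number of steps of a straight-line program. -/
def Program.stepBound : Program → ℕ
  | .skip => 1
  | .assign _ i j e => i.cost + j.cost + e.cost + 1
  | .seq P Q => P.stepBound + Q.stepBound
  | .ite _ _ _ => 0
  | .loop _ _ => 0

theorem Program.run_den (P : Program) (hP : P.straightLine = true) (s : Memory) :
    ∃ t, Run P s t (P.den s) ∧ t ≤ P.stepBound := by
  induction P generalizing s with
  | skip => exact ⟨1, .skip s, le_rfl⟩
  | assign a i j e => exact ⟨_, .assign s a i j e, le_rfl⟩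
  | seq P Q ihP ihQ =>
    simp only [Program.straightLine, Bool.and_eq_true] at hP
    obtain ⟨t, h, ht⟩ := ihP hP.1 s
    obtain ⟨t', h', ht'⟩ := ihQ hP.2 (P.den s)
    exact ⟨_, .seq h h', add_le_add ht ht'⟩
  | ite e P Q => simp [Program.straightLine] at hP
  | loop e P => simp [Program.straightLine] at hP

theorem Halts.of_den {P : Program} {s : Memory} {T : ℕ} {Q : Memory → Prop}
    (hP : P.straightLine = true) (hT : P.stepBound ≤ T) (hQ : Q (P.den s)) : Halts P s T Q := by
  obtain ⟨t, h, ht⟩ := P.run_den hP s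
  exact ⟨t, _, h, ht.trans hT, hQ⟩

/-- `for x = 0, …, b - 1` for scalar variables `x` and `b`. -/
def Program.count (x b : ℕ) (P : Program) : Program :=
  .seq (.assign x (.const 0) (.const 0) (.const 0))
    (.loop (.lt (.var x) (.var b))
      (.seq P (.assign x (.const 0) (.const 0) (.add (.var x) (.const 1)))))

/-- Induction on the remaining iterations. Initialization costs 4 and each test 8, so start and
failing test give 12; a successful test and the increment, 8 each, give the 16 added to the cost of
the body. `hInv` lets an invariant survive updates of the counter. -/
theorem Halts.count {x b N T : ℕ} {P : Program} {s : Memory} (Inv : ℕ → Memory → Prop)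
    (hx : x ∉ P.writes) (hb : b ∉ x :: P.writes) (hN : s b 0 0 = N)
    (hInv : ∀ i s' v, Inv i s' → Inv i (s'.set x 0 0 v)) (h0 : Inv 0 s)
    (hstep : ∀ i < N, ∀ s', Frame (x :: P.writes) s s' → s' x 0 0 = i → Inv i s' →
      Halts P s' T (Inv (i + 1))) :
    Halts (Program.count x b P) s (12 + N * (T + 16)) (Inv N) := by
  have key : ∀ r i s', i + r = N → Frame (x :: P.writes) s s' → s' x 0 0 = i → Inv i s' →
      Halts (.loop (.lt (.var x) (.var b))
        (.seq P (.assign x (.const 0) (.const 0) (.add (.var x) (.const 1))))) s'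
        (8 + r * (T + 16)) (Inv N) := by
    intro r
    induction r with
    | zero =>
      intro i s' hi hf hv hinv
      refine ⟨_, s', .loop_done ?_, ?_, ?_⟩
      · simp [Expr.eval, Expr.var, hf b hb, hN, hv, ← hi]
      · simp [Expr.cost, Expr.var]
      · simpa [← hi] using hinv
    | succ r ih =>
      intro i s' hi hf hv hinv
      obtain ⟨t₁, s₁, hr₁, ht₁, hq₁⟩ := hstep i (by omega) s' hf hv hinv
      have hx₁ : s₁ x 0 0 = i := by rw [hr₁.frame x hx, hv]
      have hf₂ : Frame (x :: P.writes) s (s₁.set x 0 0 ((i + 1 : ℕ) : ℤ)) := by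
        intro a ha
        have ha' := ha
        simp only [List.mem_cons, not_or] at ha'
        rw [Memory.set_of_ne _ _ _ _ ha'.1, hr₁.frame a ha'.2, hf a ha]
      obtain ⟨t₂, s₂, hr₂, ht₂, hq₂⟩ := ih (i + 1) (s₁.set x 0 0 ((i + 1 : ℕ) : ℤ)) (by omega) hf₂
        (by simp [Memory.set_same]) (hInv _ _ _ hq₁)
      have hlt : (i : ℤ) < N := by omega
      have htest : (Expr.lt (.var x) (.var b)).eval s' ≠ 0 := by
        simp [Expr.eval, Expr.var, hf b hb, hN, hv, hlt]
      have hinc : Run (.assign x (.const 0) (.const 0) (.add (.var x) (.const 1))) s₁ 8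
          (s₁.set x 0 0 ((i + 1 : ℕ) : ℤ)) := by
        have := Run.assign s₁ x (.const 0) (.const 0) (.add (.var x) (.const 1))
        simpa [Expr.eval, Expr.var, Expr.cost, hx₁] using this
      refine ⟨_, s₂, .loop_step htest (.seq hr₁ hinc) hr₂, ?_, hq₂⟩
      simp only [Expr.cost, Expr.var]
      rw [Nat.add_mul]
      omega
  obtain ⟨t, s', hr, ht, hq⟩ := key N 0 (s.set x 0 0 0) (by omega)
    (by
      intro a ha
      simp only [List.mem_cons, not_or] at ha
      exact Memory.set_of_ne _ _ _ _ ha.1)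
    (by simp [Memory.set_same]) (hInv _ _ _ h0)
  refine ⟨_, s', .seq (.assign ..) hr, ?_, hq⟩
  simp only [Expr.cost]
  omega

/-! ### Families of disjoint bundles in a partial order of width at most two -/

section Combinatorics

variable {V : Type*} [Fintype V] (le : V → V → Prop)

open Classical in
/-- The items that lie below some item of `S`. -/
noncomputable def below (S : Finset V) : Finset V :=
  Finset.univ.filter fun v => ∃ u ∈ S, le v u

variable {le}

theorem mem_below {S : Finset V} {v : V} : v ∈ below le S ↔ ∃ u ∈ S, le v u := by
  simp [below]

/-- Choose `p` with the largest down-set. If `p` is below `x`, the down-set of `x` contains that of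
`p` and is no larger, so the two agree and `x` is below `p`. -/
theorem exists_top (hrefl : ∀ x, le x x) (htrans : ∀ x y z, le x y → le y z → le x z)
    (hanti : ∀ x y, le x y → le y x → x = y) {U : Finset V} (hU : U.Nonempty) :
    ∃ p ∈ U, ∀ x ∈ U, le p x → x = p := by
  obtain ⟨p, hp, hmax⟩ := U.exists_max_image (fun p => (below le {p}).card) hU
  refine ⟨p, hp, fun x hx hpx => hanti _ _ ?_ hpx⟩
  have hsub : below le {p} ⊆ below le {x} := by
    intro z hz
    simp only [mem_below, Finset.mem_singleton, exists_eq_left] at hz ⊢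
    exact htrans _ _ _ hz hpx
  have hx' : x ∈ below le {x} := by simp [mem_below, hrefl]
  rw [← Finset.eq_of_subset_of_card_le hsub (hmax x hx)] at hx'
  simpa [mem_below] using hx'

/-- Take `p` maximal and `q` maximal among the items not below `p`, or `q = p` if there are none. An
item below neither would be incomparable to both, and `p`, `q` are incomparable to each other,
contradicting `hthree`. Anything above `q` is again not below `p`, so `q` is maximal in all of `U`.
-/
theorem exists_two_tops (hrefl : ∀ x, le x x) (htrans : ∀ x y z, le x y → le y z → le x z)
    (hanti : ∀ x y, le x y → le y x → x = y)
    (hthree : ∀ x y z, le x y ∨ le y x ∨ le x z ∨ le z x ∨ le y z ∨ le z y)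
    {U : Finset V} (hU : U.Nonempty) :
    ∃ p ∈ U, ∃ q ∈ U, (∀ x ∈ U, le x p ∨ le x q) ∧ (∀ x ∈ U, le p x → x = p) ∧
      (∀ x ∈ U, le q x → x = q) := by
  classical
  obtain ⟨p, hp, hpmax⟩ := exists_top hrefl htrans hanti hU
  by_cases hall : ∀ x ∈ U, le x p
  · exact ⟨p, hp, p, hp, fun x hx => Or.inl (hall x hx), hpmax, hpmax⟩
  · push Not at hall
    obtain ⟨y, hy, hyp⟩ := hall
    obtain ⟨q, hq, hqmax⟩ := exists_top hrefl htrans hanti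
      (U := U.filter fun x => ¬ le x p) ⟨y, by simp [hy, hyp]⟩
    simp only [Finset.mem_filter, and_imp] at hq hqmax
    refine ⟨p, hp, q, hq.1, fun x hx => ?_, hpmax, fun x hx hqx => ?_⟩
    · by_contra! hcon
      rcases hthree p q x with h | h | h | h | h | h
      · exact hq.2 (hpmax q hq.1 h ▸ hrefl _)
      · exact hq.2 h
      · exact hcon.1 (hpmax x hx h ▸ hrefl _)
      · exact hcon.1 h
      · exact hcon.2 (hqmax x hx hcon.1 h ▸ hrefl _)
      · exact hcon.2 h
    · exact hqmax x hx (fun h => hq.2 (htrans _ _ _ hqx h)) hqx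

theorem below_mono (htrans : ∀ x y z, le x y → le y z → le x z) {S S' : Finset V}
    (h : ∀ x ∈ S, ∃ y ∈ S', le x y) : below le S ⊆ below le S' := by
  intro z hz
  rw [mem_below] at hz ⊢
  obtain ⟨u, hu, hzu⟩ := hz
  obtain ⟨y, hy, huy⟩ := h u hu
  exact ⟨y, hy, htrans _ _ _ hzu huy⟩

variable [DecidableEq V]

/-- Two bundles that contain the two top items `p` and `q` can be exchanged for `{p, q}` and the
rest of their items. -/
theorem card_below_uncross (hrefl : ∀ x, le x x) (htrans : ∀ x y z, le x y → le y z → le x z)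
    (hthree : ∀ x y z, le x y ∨ le y x ∨ le x z ∨ le z x ∨ le y z ∨ le z y)
    {S S' : Finset V} {p q : V} (hdisj : Disjoint S S') (hp : p ∈ S) (hq : q ∈ S')
    (hS : ∀ x ∈ S, le x p ∨ le x q) (hS' : ∀ x ∈ S', le x p ∨ le x q)
    (hnp : ∃ y ∈ S, ¬ le y p) (hnq : ∃ x ∈ S', ¬ le x q) :
    (below le S).card + (below le S').card ≤
      (below le {p, q}).card + (below le ((S ∪ S') \ {p, q})).card := by
  obtain ⟨y, hy, hyp⟩ := hnp
  obtain ⟨x, hx, hxq⟩ := hnq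
  have hyq := (hS y hy).resolve_left hyp
  have hxp := (hS' x hx).resolve_right hxq
  have hne : ∀ a ∈ S, ∀ b ∈ S', a ≠ b := fun a ha b hb hab =>
    Finset.disjoint_left.1 hdisj ha (hab ▸ hb)
  have hyne : y ∈ (S ∪ S') \ {p, q} := by
    simp only [Finset.mem_sdiff, Finset.mem_union, Finset.mem_insert, Finset.mem_singleton]
    exact ⟨Or.inl hy, fun h => h.elim (fun h => hyp (h ▸ hrefl _)) (hne y hy q hq)⟩
  have hxne : x ∈ (S ∪ S') \ {p, q} := by
    simp only [Finset.mem_sdiff, Finset.mem_union, Finset.mem_insert, Finset.mem_singleton]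
    exact ⟨Or.inr hx, fun h => h.elim (fun h => hne p hp x hx h.symm)
      (fun h => hxq (h ▸ hrefl _))⟩
  -- The union of the two down-sets lies below `{p, q}`, and their intersection lies below the
  -- remaining items.
  rw [← Finset.card_union_add_card_inter]
  refine add_le_add (Finset.card_le_card ?_) (Finset.card_le_card ?_)
  · refine Finset.union_subset (below_mono htrans fun z hz => ?_)
      (below_mono htrans fun z hz => ?_)
    · rcases hS z hz with h | h
      · exact ⟨p, by simp, h⟩
      · exact ⟨q, by simp, h⟩
    · rcases hS' z hz with h | h
      · exact ⟨p, by simp, h⟩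
      · exact ⟨q, by simp, h⟩
  · intro z hz
    simp only [Finset.mem_inter, mem_below] at hz ⊢
    obtain ⟨⟨u, hu, hzu⟩, u', hu', hzu'⟩ := hz
    by_cases hup : u = p
    · by_cases huq : u' = q
      · subst hup huq
        -- The only case in which both dominators of `z` are removed. As `x` is below `p` only and
        -- `y` below `q` only, `x` and `y` are incomparable and neither is below `z`; so `z` is
        -- below one of them, and both were kept.
        rcases hthree x y z with h | h | h | h | h | h
        · exact absurd (htrans _ _ _ h hyq) hxq
        · exact absurd (htrans _ _ _ h hxp) hyp
        · exact absurd (htrans _ _ _ h hzu') hxq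
        · exact ⟨x, hxne, h⟩
        · exact absurd (htrans _ _ _ h hzu) hyp
        · exact ⟨y, hyne, h⟩
      · refine ⟨u', ?_, hzu'⟩
        simp only [Finset.mem_sdiff, Finset.mem_union, Finset.mem_insert, Finset.mem_singleton]
        exact ⟨Or.inr hu', fun h => h.elim (fun h => hne p hp u' hu' h.symm) huq⟩
    · refine ⟨u, ?_, hzu⟩
      simp only [Finset.mem_sdiff, Finset.mem_union, Finset.mem_insert, Finset.mem_singleton]
      exact ⟨Or.inl hu, fun h => h.elim hup (hne u hu q hq)⟩

variable {σ ι : Type*} [DecidableEq ι] {f : ℕ → σ → ℤ} {mem : σ → V → Prop}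

/-- Bundle `i` covers no more than `{p, q}`. The other bundles lie in the state `c'` generated by
their own two tops. If `p` or `q` were in `c'`, it would be below one of these tops, hence equal to
it by maximality, contradicting disjointness. Thus `hstep` charges bundle `i` and `ih` the others.
-/
theorem sum_card_below_le_of_peel (hrefl : ∀ x, le x x)
    (htrans : ∀ x y z, le x y → le y z → le x z)
    (hanti : ∀ x y, le x y → le y x → x = y)
    (hthree : ∀ x y z, le x y ∨ le y x ∨ le x z ∨ le z x ∨ le y z ∨ le z y)
    (hdown : ∀ c x y, mem c x → le y x → mem c y)
    (hpair : ∀ p q, ∃ c, ∀ x, mem c x ↔ le x p ∨ le x q)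
    (hbot : ∃ c, ∀ x, ¬ mem c x)
    {m : ℕ} (hstep : ∀ c p q c', mem c p → mem c q → (∀ x, mem c' x → mem c x) → ¬ mem c' p →
      ¬ mem c' q → ((below le {p, q}).card : ℤ) + f m c' ≤ f (m + 1) c)
    (ih : ∀ c (I : Finset ι) (b : ι → Finset V), I.card ≤ m →
      (∀ i ∈ I, ∀ x ∈ b i, mem c x) → (∀ i ∈ I, ∀ j ∈ I, i ≠ j → Disjoint (b i) (b j)) →
      ((∑ i ∈ I, (below le (b i)).card : ℕ) : ℤ) ≤ f m c)
    {c : σ} {I : Finset ι} {b : ι → Finset V} (hI : I.card ≤ m + 1)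
    (hmem : ∀ i ∈ I, ∀ x ∈ b i, mem c x)
    (hdisj : ∀ i ∈ I, ∀ j ∈ I, i ≠ j → Disjoint (b i) (b j))
    {i : ι} (hi : i ∈ I) {p q : V} (hp : p ∈ b i) (hq : q ∈ b i)
    (htop : ∀ x ∈ b i, le x p ∨ le x q)
    (hpmax : ∀ j ∈ I, ∀ x ∈ b j, le p x → x = p) (hqmax : ∀ j ∈ I, ∀ x ∈ b j, le q x → x = q) :
    ((∑ i ∈ I, (below le (b i)).card : ℕ) : ℤ) ≤ f (m + 1) c := by
  have hsub : below le (b i) ⊆ below le {p, q} := below_mono htrans fun z hz => by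
    rcases htop z hz with h | h
    · exact ⟨p, by simp, h⟩
    · exact ⟨q, by simp, h⟩
  have hw := Finset.card_le_card hsub
  have hcard : (I.erase i).card ≤ m := by
    have := Finset.card_erase_of_mem hi
    omega
  suffices h : ∃ c', (∀ x, mem c' x → mem c x) ∧ ¬ mem c' p ∧ ¬ mem c' q ∧
      ∀ j ∈ I.erase i, ∀ x ∈ b j, mem c' x by
    obtain ⟨c', hsub', hp', hq', hrest⟩ := h
    have h1 := ih c' (I.erase i) b hcard hrest fun j hj k hk =>
      hdisj j (Finset.mem_of_mem_erase hj) k (Finset.mem_of_mem_erase hk)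
    have h2 := hstep c p q c' (hmem i hi p hp) (hmem i hi q hq) hsub' hp' hq'
    rw [← Finset.add_sum_erase _ _ hi]
    push_cast at h1 ⊢
    have : ((below le (b i)).card : ℤ) ≤ (below le {p, q}).card := by exact_mod_cast hw
    linarith
  by_cases hU : ((I.erase i).biUnion b).Nonempty
  · obtain ⟨p', hp', q', hq', htop', -, -⟩ := exists_two_tops hrefl htrans hanti hthree hU
    obtain ⟨c', hc'⟩ := hpair p' q'
    simp only [Finset.mem_biUnion, Finset.mem_erase] at hp' hq' htop'
    obtain ⟨j, ⟨hji, hjI⟩, hp'⟩ := hp'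
    obtain ⟨k, ⟨hki, hkI⟩, hq'⟩ := hq'
    have hcontra : ∀ l ∈ I, l ≠ i → ∀ z ∈ b l, ∀ y ∈ b i, z ≠ y := fun l hl hli z hz y hy hzy =>
      Finset.disjoint_left.1 (hdisj l hl i hi hli) hz (hzy ▸ hy)
    refine ⟨c', fun x hx => ?_, fun h => ?_, fun h => ?_, fun l hl x hx => ?_⟩
    · rcases (hc' x).1 hx with h | h
      · exact hdown _ _ _ (hmem j hjI p' hp') h
      · exact hdown _ _ _ (hmem k hkI q' hq') h
    · rcases (hc' p).1 h with h | h
      · exact hcontra j hjI hji p' hp' p hp (hpmax j hjI p' hp' h)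
      · exact hcontra k hkI hki q' hq' p hp (hpmax k hkI q' hq' h)
    · rcases (hc' q).1 h with h | h
      · exact hcontra j hjI hji p' hp' q hq (hqmax j hjI p' hp' h)
      · exact hcontra k hkI hki q' hq' q hq (hqmax k hkI q' hq' h)
    · rw [Finset.mem_erase] at hl
      exact (hc' x).2 (htop' x ⟨l, hl, hx⟩)
  · obtain ⟨c', hc'⟩ := hbot
    refine ⟨c', fun x hx => absurd hx (hc' x), hc' p, hc' q, fun j hj x hx => ?_⟩
    exact absurd ⟨x, Finset.mem_biUnion.2 ⟨j, hj, hx⟩⟩ hU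

/-- A table `f` that dominates its one-bundle extensions bounds the total number of items below
the bundles of any family of disjoint bundles. -/
theorem sum_card_below_le (hrefl : ∀ x, le x x)
    (htrans : ∀ x y z, le x y → le y z → le x z)
    (hanti : ∀ x y, le x y → le y x → x = y)
    (hthree : ∀ x y z, le x y ∨ le y x ∨ le x z ∨ le z x ∨ le y z ∨ le z y)
    (hdown : ∀ c x y, mem c x → le y x → mem c y)
    (hpair : ∀ p q, ∃ c, ∀ x, mem c x ↔ le x p ∨ le x q)
    (hbot : ∃ c, ∀ x, ¬ mem c x)
    {K : ℕ} (hstep : ∀ m < K, ∀ c p q c', mem c p → mem c q → (∀ x, mem c' x → mem c x) →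
      ¬ mem c' p →
      ¬ mem c' q → ((below le {p, q}).card : ℤ) + f m c' ≤ f (m + 1) c)
    (hnonneg : ∀ m ≤ K, ∀ c, 0 ≤ f m c) {m : ℕ} (hm : m ≤ K) :
    ∀ c (I : Finset ι) (b : ι → Finset V), I.card ≤ m →
      (∀ i ∈ I, ∀ x ∈ b i, mem c x) → (∀ i ∈ I, ∀ j ∈ I, i ≠ j → Disjoint (b i) (b j)) →
      ((∑ i ∈ I, (below le (b i)).card : ℕ) : ℤ) ≤ f m c := by
  induction m with
  | zero =>
    intro c I b hI _ _
    rw [Finset.card_eq_zero.1 (Nat.le_zero.1 hI)]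
    simpa using hnonneg 0 hm c
  | succ m ih =>
    intro c I b hI hmem hdisj
    by_cases hU : (I.biUnion b).Nonempty
    swap
    · rw [Finset.sum_eq_zero, Nat.cast_zero]
      · exact hnonneg _ hm _
      · intro i hi
        rw [Finset.card_eq_zero, Finset.eq_empty_iff_forall_notMem]
        intro z hz
        obtain ⟨u, hu, -⟩ := mem_below.1 hz
        exact hU ⟨u, Finset.mem_biUnion.2 ⟨i, hi, hu⟩⟩
    obtain ⟨p, hp, q, hq, htop, hpmax, hqmax⟩ := exists_two_tops hrefl htrans hanti hthree hU
    simp only [Finset.mem_biUnion, forall_exists_index, and_imp] at hp hq htop hpmax hqmax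
    obtain ⟨i, hi, hp⟩ := hp
    obtain ⟨j, hj, hq⟩ := hq
    have hpmax' : ∀ j ∈ I, ∀ x ∈ b j, le p x → x = p := fun j hj x hx => hpmax x j hj hx
    have hqmax' : ∀ j ∈ I, ∀ x ∈ b j, le q x → x = q := fun j hj x hx => hqmax x j hj hx
    by_cases hij : i = j
    · subst hij
      exact sum_card_below_le_of_peel hrefl htrans hanti hthree hdown hpair hbot (hstep m hm)
        (ih (by omega)) hI hmem hdisj hi hp hq (fun x hx => htop x i hi hx) hpmax' hqmax'
    -- A bundle below its single top is peeled with the degenerate pair `(p, p)`.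
    by_cases hS : ∀ x ∈ b i, le x p
    · exact sum_card_below_le_of_peel hrefl htrans hanti hthree hdown hpair hbot (hstep m hm)
        (ih (by omega)) hI hmem hdisj hi hp hp (fun x hx => Or.inl (hS x hx)) hpmax' hpmax'
    by_cases hS' : ∀ x ∈ b j, le x q
    · exact sum_card_below_le_of_peel hrefl htrans hanti hthree hdown hpair hbot (hstep m hm)
        (ih (by omega)) hI hmem hdisj hj hq hq (fun x hx => Or.inl (hS' x hx)) hqmax' hqmax'
    push Not at hS hS'
    have hswap := card_below_uncross hrefl htrans hthree (hdisj i hi j hj hij) hp hq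
      (fun x hx => htop x i hi hx) (fun x hx => htop x j hj hx) hS hS'
    -- The uncrossed family: bundle `i` now consists of both tops, so it can be peeled.
    let b' : ι → Finset V := fun l =>
      if l = i then {p, q} else if l = j then (b i ∪ b j) \ {p, q} else b l
    have hbi : b' i = {p, q} := by simp [b']
    have hbj : b' j = (b i ∪ b j) \ {p, q} := by simp [b', Ne.symm hij]
    have hbl : ∀ l, l ≠ i → l ≠ j → b' l = b l := fun l h h' => by simp [b', h, h']
    have hb' : ∀ l ∈ I, ∀ x ∈ b' l, ∃ l' ∈ I, x ∈ b l' ∧ (l' = l ∨ (l = i ∨ l = j) ∧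
        (l' = i ∨ l' = j)) := by
      intro l hl x hx
      by_cases hli : l = i
      · subst hli
        rw [hbi, Finset.mem_insert, Finset.mem_singleton] at hx
        rcases hx with rfl | rfl
        · exact ⟨l, hl, hp, Or.inl rfl⟩
        · exact ⟨j, hj, hq, Or.inr ⟨Or.inl rfl, Or.inr rfl⟩⟩
      by_cases hlj : l = j
      · subst hlj
        rw [hbj, Finset.mem_sdiff, Finset.mem_union] at hx
        rcases hx.1 with h | h
        · exact ⟨i, hi, h, Or.inr ⟨Or.inr rfl, Or.inl rfl⟩⟩
        · exact ⟨l, hl, h, Or.inl rfl⟩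
      · exact ⟨l, hl, by rwa [hbl l hli hlj] at hx, Or.inl rfl⟩
    have hsum : ∑ l ∈ I, (below le (b l)).card ≤ ∑ l ∈ I, (below le (b' l)).card := by
      have hj' : j ∈ I.erase i := Finset.mem_erase.2 ⟨Ne.symm hij, hj⟩
      rw [← Finset.add_sum_erase _ _ hi, ← Finset.add_sum_erase _ _ hj',
        ← Finset.add_sum_erase I _ hi, ← Finset.add_sum_erase (I.erase i) _ hj', hbi, hbj]
      have hrest : ∑ l ∈ (I.erase i).erase j, (below le (b l)).card =
          ∑ l ∈ (I.erase i).erase j, (below le (b' l)).card := by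
        refine Finset.sum_congr rfl fun l hl => ?_
        simp only [Finset.mem_erase] at hl
        rw [hbl l hl.2.1 hl.1]
      omega
    refine le_trans (by exact_mod_cast hsum)
      (sum_card_below_le_of_peel hrefl htrans hanti hthree hdown hpair hbot (hstep m hm)
        (ih (by omega)) hI (b := b') (i := i) (p := p) (q := q) ?_ ?_ hi ?_ ?_ ?_ ?_ ?_)
    · intro l hl x hx
      obtain ⟨l', hl', hx', -⟩ := hb' l hl x hx
      exact hmem l' hl' x hx'
    · intro l hl l' hl' hne
      rw [Finset.disjoint_left]
      intro x hx hx'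
      obtain ⟨r, hr, hxr, h⟩ := hb' l hl x hx
      obtain ⟨r', hr', hxr', h'⟩ := hb' l' hl' x hx'
      have hrr : r = r' := by
        by_contra hrr
        exact Finset.disjoint_left.1 (hdisj r hr r' hr' hrr) hxr hxr'
      subst hrr
      have hcase : (l = i ∧ l' = j) ∨ (l = j ∧ l' = i) := by
        rcases h with h | h <;> rcases h' with h' | h' <;> grind
      rcases hcase with ⟨rfl, rfl⟩ | ⟨rfl, rfl⟩
      · rw [hbi] at hx
        rw [hbj] at hx'
        exact (Finset.mem_sdiff.1 hx').2 hx
      · rw [hbi] at hx'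
        rw [hbj] at hx
        exact (Finset.mem_sdiff.1 hx).2 hx'
    · simp [hbi]
    · simp [hbi]
    · intro x hx
      rw [hbi, Finset.mem_insert, Finset.mem_singleton] at hx
      rcases hx with rfl | rfl
      · exact Or.inl (hrefl _)
      · exact Or.inr (hrefl _)
    · intro l hl x hx
      obtain ⟨l', hl', hx', -⟩ := hb' l hl x hx
      exact hpmax' l' hl' x hx'
    · intro l hl x hx
      obtain ⟨l', hl', hx', -⟩ := hb' l hl x hx
      exact hqmax' l' hl' x hx'

end Combinatorics

/-! ### The specification of the tables -/

section Spec

variable {n : ℕ} (G : Digraph (Fin n))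

/-- Dominance between natural numbers that represent items. -/
def NatDom (x y : ℕ) : Prop := ∃ (hx : x < n) (hy : y < n), Dominates G ⟨x, hx⟩ ⟨y, hy⟩

/-- Dominance extended by a bottom item `n` and a top item `n + 1` (which is not counted as
dominating itself). -/
def ExtDom (x y : ℕ) : Prop := y = n ∨ (x = n + 1 ∧ y < n) ∨ NatDom G x y

/-- The number of pairs of extended items. -/
def numCodes (n : ℕ) : ℕ := (n + 2) * (n + 2)

/-- The pair coded by `c` dominates `u`. -/
def CodeDom (c u : ℕ) : Prop := ExtDom G (c / (n + 2)) u ∨ ExtDom G (c % (n + 2)) u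

open Classical in
/-- The number of items dominated by the pair coded by `c`. -/
noncomputable def codeWeight (c : ℕ) : ℕ := ((Finset.range n).filter fun u => CodeDom G c u).card

/-- The pairs coded by `b` and `c'` are dominated by that coded by `c`, and no item of `b` is
dominated by `c'`. -/
def Splits (c b c' : ℕ) : Prop :=
  CodeDom G c (b / (n + 2)) ∧ CodeDom G c (b % (n + 2)) ∧ CodeDom G c (c' / (n + 2)) ∧
    CodeDom G c (c' % (n + 2)) ∧ ¬ CodeDom G c' (b / (n + 2)) ∧ ¬ CodeDom G c' (b % (n + 2))

/-- The entry in row `m + 1` and column `c` of the table `F` is the maximum over those `b` and `c'`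
with `D b c'` that split `c`, and `BP`, `BQ`, `C` record where it is attained. -/
def Entry (F BP BQ C : ℤ → ℤ → ℤ) (D : ℕ → ℕ → Prop) (m c : ℕ) : Prop :=
  0 ≤ F (m + 1) c ∧
  (∀ b < numCodes n, ∀ c' < numCodes n, D b c' → Splits G c b c' →
    F m c' + codeWeight G b ≤ F (m + 1) c) ∧
  -- The default choice is an empty bundle: both recorded items are the bottom `n`, and the state
  -- stays `c`.
  ((F (m + 1) c = 0 ∧ BP (m + 1) c = n ∧ BQ (m + 1) c = n ∧ C (m + 1) c = c) ∨
    ∃ b < numCodes n, ∃ c' < numCodes n, Splits G c b c' ∧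
      F (m + 1) c = F m c' + codeWeight G b ∧ BP (m + 1) c = ((b / (n + 2) : ℕ) : ℤ) ∧
      BQ (m + 1) c = ((b % (n + 2) : ℕ) : ℤ) ∧ C (m + 1) c = c')

variable {G}

theorem Entry.mono {F BP BQ C : ℤ → ℤ → ℤ} {D D' : ℕ → ℕ → Prop} {m c : ℕ}
    (h : Entry G F BP BQ C D m c)
    (hD : ∀ b < numCodes n, ∀ c' < numCodes n, D' b c' → D b c') :
    Entry G F BP BQ C D' m c :=
  ⟨h.1, fun b hb c' hc' hd => h.2.1 b hb c' hc' (hD b hb c' hc' hd), h.2.2⟩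

/-- An entry depends only on its own cell and on row `m` of `F`; writing to a cell of row `m₀ + 1`
cannot disturb entries completed before it. -/
theorem Entry.congr {F BP BQ C F' BP' BQ' C' : ℤ → ℤ → ℤ} {D : ℕ → ℕ → Prop} {m c m₀ c₀ : ℕ}
    (h : Entry G F BP BQ C D m c)
    (hF : ∀ x y : ℕ, x ≠ m₀ + 1 ∨ y ≠ c₀ → F' x y = F x y)
    (hBP : ∀ x y : ℕ, x ≠ m₀ + 1 ∨ y ≠ c₀ → BP' x y = BP x y)
    (hBQ : ∀ x y : ℕ, x ≠ m₀ + 1 ∨ y ≠ c₀ → BQ' x y = BQ x y)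
    (hC : ∀ x y : ℕ, x ≠ m₀ + 1 ∨ y ≠ c₀ → C' x y = C x y)
    (hm : m < m₀ ∨ m = m₀ ∧ c ≠ c₀) : Entry G F' BP' BQ' C' D m c := by
  have hrow : ∀ c' : ℕ, F' m c' = F m c' := fun c' => hF m c' (by omega)
  have e : ((m : ℤ) + 1) = ((m + 1 : ℕ) : ℤ) := by push_cast; rfl
  have hcell : m + 1 ≠ m₀ + 1 ∨ c ≠ c₀ := by omega
  unfold Entry at h ⊢
  rw [e] at h ⊢
  rw [hF _ _ hcell, hBP _ _ hcell, hBQ _ _ hcell, hC _ _ hcell]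
  refine ⟨h.1, fun b hb c' hc' hd hs => ?_, ?_⟩
  · rw [hrow]
    exact h.2.1 b hb c' hc' hd hs
  · rcases h.2.2 with h | ⟨b, hb, c', hc', h⟩
    · exact Or.inl h
    · refine Or.inr ⟨b, hb, c', hc', ?_⟩
      rw [hrow]
      exact h

end Spec

/-! ### The program

Array `1` is turned into the dominance matrix with a bottom item `n` and a top item `n + 1`; the
arrays `5` and `6` list all pairs of extended items and `7` their weights; the arrays `8` to `11`
hold the table of optimal values and the choices that attain them. The scalars `4`, `12`, `13` are
the number of extended items, the number of pairs, and `min n k`; `18` is the current pair of the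
final traversal and `19` is `n * k`; `14` to `17` are counters. -/

section Programs

open CGMinSum.Expr CGMinSum.Program

/-- Initialize the diagonal. -/
def diagonal : Program :=
  .count 15 0 (.assign 1 (var 15) (var 15) (const 1))

/-- Warshall's algorithm. -/
def closure : Program :=
  .count 14 0 (.count 15 0 (.count 16 0
    (.ite (get 1 (var 15) (var 14))
      (.ite (get 1 (var 14) (var 16)) (.assign 1 (var 15) (var 16) (const 1)) .skip) .skip)))

/-- The rows and columns of the bottom and the top item. -/
def border : Program :=
  .seq (.count 15 0
    (.seq (.assign 1 (var 15) (var 0) (const 1))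
    (.seq (.assign 1 (var 15) (add (var 0) (const 1)) (const 0))
    (.seq (.assign 1 (var 0) (var 15) (const 0))
      (.assign 1 (add (var 0) (const 1)) (var 15) (const 1))))))
  (.seq (.assign 1 (var 0) (var 0) (const 1))
  (.seq (.assign 1 (var 0) (add (var 0) (const 1)) (const 0))
  (.seq (.assign 1 (add (var 0) (const 1)) (var 0) (const 1))
  (.seq (.assign 1 (add (var 0) (const 1)) (add (var 0) (const 1)) (const 0))
    (.assign 4 (const 0) (const 0) (add (var 0) (const 2)))))))

/-- The list of all pairs of extended items. -/
def codes : Program :=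
  .count 15 4 (.count 16 4
    (.seq (.assign 5 (var 12) (const 0) (var 15))
    (.seq (.assign 6 (var 12) (const 0) (var 16))
      (.assign 12 (const 0) (const 0) (add (var 12) (const 1))))))

/-- The first item of a pair. -/
def fstItem (c : Expr) : Expr := get 5 c (const 0)

/-- The second item of a pair. -/
def sndItem (c : Expr) : Expr := get 6 c (const 0)

/-- Positive if the pair coded by `c` dominates `u`, and `0` otherwise. -/
def domExpr (c u : Expr) : Expr := add (get 1 (fstItem c) u) (get 1 (sndItem c) u)

/-- The weights of all pairs. -/
def weights : Program :=
  .count 15 12 (.count 16 0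
    (.ite (domExpr (var 15) (var 16))
      (.assign 7 (var 15) (const 0) (add (get 7 (var 15) (const 0)) (const 1))) .skip))

/-- The scalar `13` becomes `min n k`. -/
def bundleBound : Program :=
  .ite (lt (get 0 (const 0) (const 0)) (get 0 (const 0) (const 1)))
    (.assign 13 (const 0) (const 0) (get 0 (const 0) (const 0)))
    (.assign 13 (const 0) (const 0) (get 0 (const 0) (const 1)))

/-- Tests whether the pairs coded by the scalars `16` and `17` split that coded by `15`. -/
def splitsExpr : Expr :=
  -- Conjunction by counting: six tests with values 0 or 1 all succeed exactly when their sum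
  -- exceeds 5.
  lt (const 5)
    (add (lt (const 0) (domExpr (var 15) (fstItem (var 16))))
    (add (lt (const 0) (domExpr (var 15) (sndItem (var 16))))
    (add (lt (const 0) (domExpr (var 15) (fstItem (var 17))))
    (add (lt (const 0) (domExpr (var 15) (sndItem (var 17))))
    (add (lt (domExpr (var 17) (fstItem (var 16))) (const 1))
      (lt (domExpr (var 17) (sndItem (var 16))) (const 1)))))))

/-- The value of the choice of the scalars `16` and `17`. -/
def candidate : Expr := add (get 8 (var 14) (var 17)) (get 7 (var 16) (const 0))

/-- The index of the row under construction. -/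
def nextRow : Expr := add (var 14) (const 1)

/-- Improve an entry of the table by one choice. -/
def improve : Program :=
  .ite splitsExpr
    (.ite (lt (get 8 nextRow (var 15)) candidate)
      (.seq (.assign 8 nextRow (var 15) candidate)
      (.seq (.assign 9 nextRow (var 15) (fstItem (var 16)))
      (.seq (.assign 10 nextRow (var 15) (sndItem (var 16)))
        (.assign 11 nextRow (var 15) (var 17)))))
      .skip)
    .skip

/-- Initialize an entry of the table. -/
def initEntry : Program :=
  .seq (.assign 8 nextRow (var 15) (const 0))
  (.seq (.assign 9 nextRow (var 15) (var 0))
  (.seq (.assign 10 nextRow (var 15) (var 0))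
    (.assign 11 nextRow (var 15) (var 15))))

/-- The table of optimal values. -/
def table : Program :=
  .count 14 13 (.count 15 12 (.seq initEntry (.count 16 12 (.count 17 12 improve))))

/-- The row at which the final traversal stands. -/
def traceRow : Expr := sub (var 13) (var 14)

/-- Label the items along the choices recorded in the table. -/
def traverse : Program :=
  .seq (.assign 18 (const 0) (const 0) (sub (var 12) (const 1)))
  (.count 14 13
    -- The row number serves as the agent's number. A default choice writes to cell `n`, outside the
    -- labels of the items.
    (.seq (.assign 3 (get 9 traceRow (var 18)) (const 0) traceRow)
    (.seq (.assign 3 (get 10 traceRow (var 18)) (const 0) traceRow)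
      (.assign 18 (const 0) (const 0) (get 11 traceRow (var 18))))))

/-- Answer the decision problem. -/
def answer : Program :=
  -- Without multiplication, `n * k` is accumulated by `n` additions, so the time does not depend on
  -- `k`.
  .seq (.count 15 0 (.assign 19 (const 0) (const 0)
    (add (var 19) (get 0 (const 0) (const 1)))))
  (.assign 2 (const 0) (const 0)
    (sub (const 1) (lt (get 0 (const 0) (const 2))
      (sub (var 19) (get 8 (var 13) (sub (var 12) (const 1)))))))

/-- The whole program. -/
def solver : Program :=
  .seq diagonal (.seq closure (.seq border (.seq codes (.seq weights (.seq bundleBound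
    (.seq table (.seq traverse answer)))))))

end Programs

/-! ### Correctness of the dominance matrix and of the list of pairs -/

section Matrix

variable {n : ℕ} (G : Digraph (Fin n))

/-- Adjacency of natural numbers that represent items. -/
def NatAdj (x y : ℕ) : Prop := ∃ (hx : x < n) (hy : y < n), G.Adj ⟨x, hx⟩ ⟨y, hy⟩

/-- Reachability along paths whose inner vertices are smaller than `m`. -/
def Warshall : ℕ → ℕ → ℕ → Prop
  | 0, x, y => x = y ∨ NatAdj G x y
  | m + 1, x, y => Warshall m x y ∨ (Warshall m x m ∧ Warshall m m y)

variable {G}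

theorem Warshall.mono {m m' x y : ℕ} (h : m ≤ m') (hw : Warshall G m x y) :
    Warshall G m' x y := by
  induction h with
  | refl => exact hw
  | step _ ih => exact Or.inl ih

/-- Induction on `m`. If the joint `z` is the last admitted inner vertex, the definition applies; if
it is smaller, the two walks are joined at `z`, with any detours through the last vertex merged into
one. -/
theorem Warshall.trans {m x z y : ℕ} (hz : z < m) (h : Warshall G m x z)
    (h' : Warshall G m z y) : Warshall G m x y := by
  induction m generalizing x z y with
  | zero => omega
  | succ m ih =>
    rcases Nat.lt_succ_iff_lt_or_eq.1 hz with hz | rfl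
    · rcases h with h | ⟨h, h₂⟩ <;> rcases h' with h' | ⟨h', h₂'⟩
      · exact Or.inl (ih hz h h')
      · exact Or.inr ⟨ih hz h h', h₂'⟩
      · exact Or.inr ⟨h, ih hz h₂ h'⟩
      · exact Or.inr ⟨h, h₂'⟩
    · have h1 : Warshall G z x z := by rcases h with h | h; exacts [h, h.1]
      have h2 : Warshall G z z y := by rcases h' with h | h; exacts [h, h.2]
      exact Or.inr ⟨h1, h2⟩

theorem NatDom.warshall {x y : ℕ} (h : NatDom G x y) : Warshall G n x y := by
  obtain ⟨hx, hy, h⟩ := h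
  unfold Dominates at h
  have : ∀ u v : Fin n, Relation.ReflTransGen G.Adj u v → Warshall G n u v := by
    intro u v h
    induction h with
    | refl => exact Warshall.mono (Nat.zero_le _) (Or.inl rfl)
    | @tail w v _ hwv ih =>
      exact Warshall.trans w.2 ih (Warshall.mono (Nat.zero_le _) (Or.inr ⟨w.2, v.2, hwv⟩))
  exact this _ _ h

theorem NatDom.refl {x : ℕ} (hx : x < n) : NatDom G x x := ⟨hx, hx, .refl⟩

theorem NatDom.trans {x y z : ℕ} (h : NatDom G x y) (h' : NatDom G y z) : NatDom G x z := by
  obtain ⟨hx, _, h⟩ := h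
  obtain ⟨_, hz, h'⟩ := h'
  exact ⟨hx, hz, Relation.ReflTransGen.trans h h'⟩

theorem NatAdj.natDom {x y : ℕ} (h : NatAdj G x y) : NatDom G x y := by
  obtain ⟨hx, hy, h⟩ := h
  exact ⟨hx, hy, .single h⟩

-- Here and below, 1000 is a generous budget for a loop body, checked by `decide`.
open Classical in
theorem halts_diagonal {s : Memory} (hn : s 0 0 0 = n)
    (hA : ∀ x < n, ∀ y < n, s 1 x y = if NatAdj G x y then 1 else 0) :
    Halts diagonal s (12 + n * (1000 + 16)) (fun s' => ∀ x < n, ∀ y < n,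
      (s' 1 x y = 0 ∨ s' 1 x y = 1) ∧ (s' 1 x y = 1 → NatDom G x y) ∧
        (Warshall G 0 x y → s' 1 x y = 1)) := by
  refine Halts.mono (Halts.count (N := n) (fun i s' => ∀ x < n, ∀ y < n,
      (s' 1 x y = 0 ∨ s' 1 x y = 1) ∧ (s' 1 x y = 1 → NatDom G x y) ∧
        (NatAdj G x y → s' 1 x y = 1) ∧ (x = y → x < i → s' 1 x y = 1))
    (by decide) (by decide) hn ?_ ?_ ?_) le_rfl ?_
  · intro i s' v h
    simpa [Memory.set_of_ne] using h
  · intro x hx y hy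
    rw [hA x hx y hy]
    by_cases h : NatAdj G x y
    · simp [h, h.natDom]
    · simp [h]
  · intro i hi s' hf hv hinv
    refine Halts.of_den (by decide) (by decide) ?_
    intro x hx y hy
    have := hinv x hx y hy
    simp only [Program.den, Expr.eval, Expr.var, hv, Memory.set_same, Nat.cast_inj]
    by_cases hxy : x = i ∧ y = i
    · rw [if_pos hxy]
      have hd : NatDom G x y := by rw [hxy.1, hxy.2]; exact NatDom.refl hi
      simp [hd]
    · rw [if_neg hxy]
      refine ⟨this.1, this.2.1, this.2.2.1, fun h h' => this.2.2.2 h ?_⟩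
      omega
  · intro s' h _ x hx y hy
    obtain ⟨h1, h2, h3, h4⟩ := h x hx y hy
    refine ⟨h1, h2, fun h => ?_⟩
    rcases h with h | h
    · exact h4 h hx
    · exact h3 h

variable (G) in
/-- The invariant of Warshall's algorithm. -/
def ClosureInv (R : ℤ → ℤ → ℤ) (m : ℕ) (D : ℕ → ℕ → Prop) : Prop :=
  ∀ x < n, ∀ y < n, (R x y = 0 ∨ R x y = 1) ∧ (R x y = 1 → NatDom G x y) ∧
    (Warshall G m x y → R x y = 1) ∧ (D x y → Warshall G (m + 1) x y → R x y = 1)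

theorem ClosureInv.mono {R : ℤ → ℤ → ℤ} {m : ℕ} {D D' : ℕ → ℕ → Prop} (h : ClosureInv G R m D)
    (hD : ∀ x < n, ∀ y < n, D' x y → D x y) : ClosureInv G R m D' := fun x hx y hy =>
  ⟨(h x hx y hy).1, (h x hx y hy).2.1, (h x hx y hy).2.2.1,
    fun hd => (h x hx y hy).2.2.2 (hD x hx y hy hd)⟩

/-- The matrix is updated in place and may run ahead of the stage, so the invariant only keeps it
between `Warshall G m` and dominance. After stage `n` the two bounds coincide by `NatDom.warshall`.
-/
theorem halts_closure {s : Memory} (hn : s 0 0 0 = n)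
    (hA : ∀ x < n, ∀ y < n, (s 1 x y = 0 ∨ s 1 x y = 1) ∧ (s 1 x y = 1 → NatDom G x y) ∧
        (Warshall G 0 x y → s 1 x y = 1)) :
    Halts closure s (12 + n * ((12 + n * ((12 + n * (1000 + 16)) + 16)) + 16))
      (fun s' => ∀ x < n, ∀ y < n, (s' 1 x y = 0 ∨ s' 1 x y = 1) ∧
        (s' 1 x y = 1 ↔ NatDom G x y)) := by
  refine Halts.mono (Halts.count (N := n) (fun m s' => ClosureInv G (s' 1) m fun _ _ => False)
    (by decide) (by decide) hn ?_ ?_ ?_) le_rfl ?_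
  · intro i s' v h
    simpa [Memory.set_of_ne] using h
  · intro x hx y hy
    simpa using hA x hx y hy
  · intro m hm s₁ hf₁ hv₁ hinv₁
    refine Halts.mono (Halts.count (N := n) (fun i s' => ClosureInv G (s' 1) m fun x _ => x < i)
      (by decide) (by decide) (by rw [hf₁ 0 (by decide), hn]) ?_ ?_ ?_) le_rfl ?_
    · intro i s' v h
      simpa [Memory.set_of_ne] using h
    · exact hinv₁.mono (by simp)
    · intro i hi s₂ hf₂ hv₂ hinv₂
      refine Halts.mono (Halts.count (N := n)
        (fun j s' => ClosureInv G (s' 1) m fun x y => x < i ∨ (x = i ∧ y < j))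
        (by decide) (by decide) (by rw [hf₂ 0 (by decide), hf₁ 0 (by decide), hn]) ?_ ?_ ?_)
        le_rfl ?_
      · intro i s' v h
        simpa [Memory.set_of_ne] using h
      · exact hinv₂.mono (by simp)
      · intro j hj s₃ hf₃ hv₃ hinv₃
        have hm' : s₃ 14 0 0 = m := by rw [hf₃ 14 (by decide), hf₂ 14 (by decide), hv₁]
        have hi' : s₃ 15 0 0 = i := by rw [hf₃ 15 (by decide), hv₂]
        have him := hinv₃ i hi m hm
        have hmj := hinv₃ m hm j hj
        have hskip : ¬ (Warshall G m i m ∧ Warshall G m m j) →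
            ClosureInv G (s₃ 1) m fun x y => x < i ∨ (x = i ∧ y < j + 1) := by
          intro hnot x hx y hy
          have := hinv₃ x hx y hy
          refine ⟨this.1, this.2.1, this.2.2.1, fun h hw => ?_⟩
          by_cases hxy : x = i ∧ y = j
          · obtain ⟨rfl, rfl⟩ := hxy
            rcases hw with hw | hw
            · exact this.2.2.1 hw
            · exact absurd hw hnot
          · exact this.2.2.2 (by omega) hw
        refine Halts.ite (T := 900) (by decide) (fun h1 => Halts.ite (T := 800) (by decide)
          (fun h2 => Halts.of_den (by decide) (by decide) ?_)
          (fun h2 => Halts.of_den (by decide) (by decide) (hskip ?_)))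
          (fun h1 => Halts.of_den (by decide) (by decide) (hskip ?_))
        · simp only [Expr.eval, Expr.var, hv₃, hm', hi'] at h1 h2
          have h1' := him.1.resolve_left h1
          have h2' := hmj.1.resolve_left h2
          intro x hx y hy
          have := hinv₃ x hx y hy
          simp only [Program.den, Expr.eval, Expr.var, hv₃, hi', Memory.set_same, Nat.cast_inj]
          by_cases hxy : x = i ∧ y = j
          · rw [if_pos hxy]
            have hd : NatDom G x y := by
              rw [hxy.1, hxy.2]
              exact (him.2.1 h1').trans (hmj.2.1 h2')
            simp [hd]
          · rw [if_neg hxy]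
            refine ⟨this.1, this.2.1, this.2.2.1, fun h => this.2.2.2 ?_⟩
            omega
        · simp only [Expr.eval, Expr.var, hv₃, hm'] at h2
          intro h
          have := hmj.2.2.1 h.2
          omega
        · simp only [Expr.eval, Expr.var, hm', hi'] at h1
          intro h
          have := him.2.2.1 h.1
          omega
      · intro s' h _
        exact h.mono (by intros; omega)
    · intro s' h _ x hx y hy
      obtain ⟨h1, h2, h3, h4⟩ := h x hx y hy
      exact ⟨h1, h2, fun hw => h4 hx hw, fun h => h.elim⟩
  · intro s' h _ x hx y hy
    obtain ⟨h1, h2, h3, -⟩ := h x hx y hy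
    exact ⟨h1, h2, fun hd => h3 hd.warshall⟩

open Classical in
theorem halts_border {s : Memory} (hn : s 0 0 0 = n)
    (hA : ∀ x < n, ∀ y < n, (s 1 x y = 0 ∨ s 1 x y = 1) ∧ (s 1 x y = 1 ↔ NatDom G x y)) :
    Halts border s ((12 + n * (1000 + 16)) + 1000)
      (fun s' => (∀ x < n + 2, ∀ y < n + 2, s' 1 x y = if ExtDom G x y then 1 else 0) ∧
        s' 4 0 0 = (n + 2 : ℕ)) := by
  have hdom : ∀ x y, NatDom G x y → x < n ∧ y < n := fun x y ⟨hx, hy, _⟩ => ⟨hx, hy⟩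
  refine Halts.seq (R := fun s' => (∀ x < n, ∀ y < n,
      s' 1 x y = if NatDom G x y then 1 else 0) ∧ ∀ x < n, s' 1 x n = 1 ∧ s' 1 x (n + 1) = 0 ∧
        s' 1 n x = 0 ∧ s' 1 (n + 1) x = 1) ?_ ?_
  · refine Halts.mono (Halts.count (N := n) (fun i s' => (∀ x < n, ∀ y < n,
      s' 1 x y = if NatDom G x y then 1 else 0) ∧ ∀ x < i, s' 1 x n = 1 ∧ s' 1 x (n + 1) = 0 ∧
        s' 1 n x = 0 ∧ s' 1 (n + 1) x = 1) (by decide) (by decide) hn ?_ ?_ ?_) le_rfl ?_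
    · intro i s' v h
      simpa [Memory.set_of_ne] using h
    · refine ⟨fun x hx y hy => ?_, by simp⟩
      obtain ⟨h1, h2⟩ := hA x hx y hy
      by_cases hd : NatDom G x y
      · simp [hd, h2.2 hd]
      · simp only [hd, if_false]
        exact h1.resolve_right fun h => hd (h2.1 h)
    · intro i hi s' hf hv hinv
      have hn' : s' 0 0 0 = n := by rw [hf 0 (by decide), hn]
      refine Halts.of_den (by decide) (by decide) ⟨fun x hx y hy => ?_, fun x hx => ?_⟩
      · rw [← hinv.1 x hx y hy]
        simp only [Program.den, Expr.eval, Expr.var, ne_eq, zero_ne_one, OfNat.ofNat_ne_one,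
          not_false_eq_true, Memory.set_of_ne, Memory.set_same, hv, hn']
        rw [if_neg (by omega), if_neg (by omega), if_neg (by omega), if_neg (by omega)]
      · simp only [Program.den, Expr.eval, Expr.var, ne_eq, zero_ne_one, OfNat.ofNat_ne_one,
          not_false_eq_true, Memory.set_of_ne, Memory.set_same, hv, hn']
        have := fun h : x < i => hinv.2 x h
        refine ⟨?_, ?_, ?_, ?_⟩ <;> grind
    · intro s' h _
      exact h
  · intro s' h hf
    have hn' : s' 0 0 0 = n := by rw [hf 0 (by decide), hn]
    refine Halts.of_den (by decide) (by decide) ⟨fun x hx y hy => ?_, ?_⟩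
    · simp only [Program.den, Expr.eval, Expr.var, ne_eq, zero_ne_one, OfNat.one_ne_ofNat,
          not_false_eq_true, Memory.set_of_ne, Memory.set_same, hn']
      have h1 := h.1 x
      have h2 := h.2 x
      have h3 := h.2 y
      have h4 := hdom x y
      unfold ExtDom
      obtain hx | rfl | rfl : x < n ∨ x = n ∨ x = n + 1 := by omega
      · obtain hy | rfl | rfl : y < n ∨ y = n ∨ y = n + 1 := by omega
        · rw [if_neg (by omega), if_neg (by omega), if_neg (by omega), if_neg (by omega),
            h1 hx y hy]
          congr 1
          simp only [eq_iff_iff]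
          constructor
          · exact fun h => Or.inr (Or.inr h)
          · rintro (h | h | h)
            · omega
            · omega
            · exact h
        · rw [if_neg (by omega), if_neg (by omega), if_neg (by omega), if_neg (by omega)]
          simp [(h2 hx).1]
        · push_cast
          rw [if_neg (by omega), if_neg (by omega), if_neg (by omega), if_neg (by omega),
            (h2 hx).2.1, if_neg]
          rintro (h | h | h)
          · omega
          · omega
          · have := h4 h
            omega
      · obtain hy | rfl | rfl : y < x ∨ y = x ∨ y = x + 1 := by omega
        · rw [if_neg (by omega), if_neg (by omega), if_neg (by omega), if_neg (by omega),
            (h3 hy).2.2.1, if_neg]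
          rintro (h | h | h)
          · omega
          · omega
          · have := h4 h
            omega
        · simp
        · push_cast
          rw [if_neg (by omega), if_neg (by omega), if_pos (by omega), if_neg]
          rintro (h | h | h)
          · omega
          · omega
          · have := h4 h
            omega
      · obtain hy | rfl | rfl : y < n ∨ y = n ∨ y = n + 1 := by omega
        · push_cast
          rw [if_neg (by omega), if_neg (by omega), if_neg (by omega), if_neg (by omega),
            (h3 hy).2.2.2, if_pos]
          exact Or.inr (Or.inl ⟨rfl, hy⟩)
        · push_cast
          rw [if_neg (by omega), if_pos (by omega), if_pos (Or.inl rfl)]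
        · push_cast
          rw [if_pos (by omega), if_neg]
          rintro (h | h | h)
          · omega
          · omega
          · have := h4 h
            omega
    · simp [Program.den, Expr.eval, Expr.var, Memory.set_of_ne, Memory.set_same, hn']

/-- A running counter takes the values `i * (n + 2) + j`, so quotient and remainder are tabulated
without multiplication or division. -/
theorem halts_codes {s : Memory} (hN : s 4 0 0 = (n + 2 : ℕ)) (h0 : s 12 0 0 = 0) :
    Halts codes s (12 + (n + 2) * ((12 + (n + 2) * (1000 + 16)) + 16)) (fun s' =>
      s' 12 0 0 = numCodes n ∧ ∀ c < numCodes n, s' 5 c 0 = ((c / (n + 2) : ℕ) : ℤ) ∧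
        s' 6 c 0 = ((c % (n + 2) : ℕ) : ℤ)) := by
  refine Halts.mono (Halts.count (N := n + 2) (fun i s' => s' 12 0 0 = (i * (n + 2) : ℕ) ∧
      ∀ c < i * (n + 2), s' 5 c 0 = ((c / (n + 2) : ℕ) : ℤ) ∧
        s' 6 c 0 = ((c % (n + 2) : ℕ) : ℤ)) (by decide) (by decide) hN ?_ ?_ ?_) le_rfl ?_
  · intro i s' v h
    simpa [Memory.set_of_ne] using h
  · simpa using h0
  · intro i hi s₁ hf₁ hv₁ hinv₁
    refine Halts.mono (Halts.count (N := n + 2)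
      (fun j s' => s' 12 0 0 = (i * (n + 2) + j : ℕ) ∧
        ∀ c < i * (n + 2) + j, s' 5 c 0 = ((c / (n + 2) : ℕ) : ℤ) ∧
          s' 6 c 0 = ((c % (n + 2) : ℕ) : ℤ))
      (by decide) (by decide) (by rw [hf₁ 4 (by decide), hN]) ?_ ?_ ?_) le_rfl ?_
    · intro i s' v h
      simpa [Memory.set_of_ne] using h
    · simpa using hinv₁
    · intro j hj s₂ hf₂ hv₂ hinv₂
      have hi' : s₂ 15 0 0 = i := by rw [hf₂ 15 (by decide), hv₁]
      refine Halts.of_den (by decide) (by decide) ⟨?_, fun c hc => ?_⟩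
      · simp [Program.den, Expr.eval, Expr.var, Memory.set_of_ne, Memory.set_same, hinv₂.1]
        ring
      · by_cases hc' : c = i * (n + 2) + j
        · have h1 : c / (n + 2) = i := by
            rw [hc', mul_comm, Nat.mul_add_div (by omega), Nat.div_eq_of_lt hj, add_zero]
          have h2 : c % (n + 2) = j := by
            rw [hc', mul_comm, Nat.mul_add_mod, Nat.mod_eq_of_lt hj]
          rw [h1, h2]
          simp [Program.den, Expr.eval, Expr.var, Memory.set_of_ne, Memory.set_same, hinv₂.1, hi',
            hv₂, hc']
        · have hne : (c : ℤ) ≠ (i * (n + 2) + j : ℕ) := by exact_mod_cast hc'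
          have hlt : c < i * (n + 2) + j := by omega
          simp only [Program.den, Expr.eval, Expr.var, ne_eq, Nat.reduceEqDiff, not_false_eq_true,
            Memory.set_of_ne, Memory.set_same, hinv₂.1, hne,
            false_and, if_false]
          exact hinv₂.2 c hlt
    · intro s' h _
      have e : (i + 1) * (n + 2) = i * (n + 2) + (n + 2) := by ring
      rw [e]
      exact h
  · intro s' h _
    exact h

end Matrix

/-! ### Correctness of the table -/

section Table

variable {n : ℕ} (G : Digraph (Fin n))

open Classical in
/-- The memory holds the extended dominance matrix and the list of pairs. -/
structure Prepared (s : Memory) : Prop where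
  size : s 0 0 0 = n
  dom : ∀ x < n + 2, ∀ y < n + 2, s 1 x y = if ExtDom G x y then 1 else 0
  num : s 12 0 0 = numCodes n
  fst : ∀ c < numCodes n, s 5 c 0 = ((c / (n + 2) : ℕ) : ℤ)
  snd : ∀ c < numCodes n, s 6 c 0 = ((c % (n + 2) : ℕ) : ℤ)

variable {G}

theorem Prepared.congr {s s' : Memory} (h : Prepared G s) (h0 : s' 0 = s 0) (h1 : s' 1 = s 1)
    (h12 : s' 12 = s 12) (h5 : s' 5 = s 5) (h6 : s' 6 = s 6) : Prepared G s' := by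
  refine ⟨?_, ?_, ?_, ?_, ?_⟩
  · rw [h0]; exact h.size
  · rw [h1]; exact h.dom
  · rw [h12]; exact h.num
  · rw [h5]; exact h.fst
  · rw [h6]; exact h.snd

theorem fst_lt {c : ℕ} (hc : c < numCodes n) : c / (n + 2) < n + 2 :=
  Nat.div_lt_of_lt_mul hc

theorem snd_lt (c : ℕ) : c % (n + 2) < n + 2 := Nat.mod_lt _ (by omega)

theorem Prepared.domExpr {s : Memory} (h : Prepared G s) {e f : Expr} {c u : ℕ}
    (hc : c < numCodes n) (hu : u < n + 2) (he : e.eval s = c) (hf : f.eval s = u) :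
    0 ≤ (domExpr e f).eval s ∧ ((domExpr e f).eval s ≠ 0 ↔ CodeDom G c u) := by
  simp only [CGMinSum.domExpr, fstItem, sndItem, Expr.eval, he, hf, h.fst c hc, h.snd c hc,
    h.dom _ (fst_lt hc) _ hu, h.dom _ (snd_lt c) _ hu]
  unfold CodeDom
  by_cases h1 : ExtDom G (c / (n + 2)) u <;> by_cases h2 : ExtDom G (c % (n + 2)) u <;>
    simp [h1, h2]

theorem halts_weights {s : Memory} (h : Prepared G s) (h7 : ∀ c : ℕ, s 7 c 0 = 0) :
    Halts weights s (12 + numCodes n * ((12 + n * (1000 + 16)) + 16)) (fun s' =>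
      ∀ c < numCodes n, s' 7 c 0 = codeWeight G c) := by
  classical
  refine Halts.mono (Halts.count (N := numCodes n)
    (fun i s' => (∀ c < i, s' 7 c 0 = codeWeight G c) ∧ ∀ c : ℕ, i ≤ c → s' 7 c 0 = 0)
    (by decide) (by decide) h.num ?_ ?_ ?_) le_rfl ?_
  · intro i s' v h
    simpa [Memory.set_of_ne] using h
  · simpa using h7
  · intro i hi s₁ hf₁ hv₁ hinv₁
    refine Halts.mono (Halts.count (N := n)
      (fun j s' => (∀ c < i, s' 7 c 0 = codeWeight G c) ∧
        (s' 7 i 0 = ((Finset.range j).filter fun u => CodeDom G i u).card) ∧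
        ∀ c : ℕ, i + 1 ≤ c → s' 7 c 0 = 0)
      (by decide) (by decide) (by rw [hf₁ 0 (by decide), h.size]) ?_ ?_ ?_) le_rfl ?_
    · intro i s' v h
      simpa [Memory.set_of_ne] using h
    · exact ⟨hinv₁.1, by simpa using hinv₁.2 i le_rfl, fun c hc => hinv₁.2 c (by omega)⟩
    · intro j hj s₂ hf₂ hv₂ hinv₂
      have hi' : s₂ 15 0 0 = i := by rw [hf₂ 15 (by decide), hv₁]
      have hp : Prepared G s₂ := (h.congr (hf₁ 0 (by decide)) (hf₁ 1 (by decide))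
        (hf₁ 12 (by decide)) (hf₁ 5 (by decide)) (hf₁ 6 (by decide))).congr (hf₂ 0 (by decide))
        (hf₂ 1 (by decide)) (hf₂ 12 (by decide)) (hf₂ 5 (by decide)) (hf₂ 6 (by decide))
      have htest := (hp.domExpr (e := .var 15) (f := .var 16) hi (show j < n + 2 by omega)
        (by simpa [Expr.eval, Expr.var] using hi')
        (by simpa [Expr.eval, Expr.var] using hv₂)).2
      refine Halts.ite (T := 900) (by decide)
        (fun h1 => Halts.of_den (by decide) (by decide) ?_)
        (fun h1 => Halts.of_den (by decide) (by decide) ?_)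
      · simp only [Program.den, Expr.eval, Expr.var, Memory.set_same, hi', Nat.cast_inj,
          and_true]
        refine ⟨fun c hc => ?_, ?_, fun c hc => ?_⟩
        · rw [if_neg (by omega)]; exact hinv₂.1 c hc
        · rw [if_pos trivial, hinv₂.2.1, Finset.range_add_one, Finset.filter_insert,
            if_pos (htest.1 h1), Finset.card_insert_of_notMem (by simp)]
          push_cast; rfl
        · rw [if_neg (by omega)]; exact hinv₂.2.2 c hc
      · refine ⟨hinv₂.1, ?_, hinv₂.2.2⟩
        rw [Finset.range_add_one, Finset.filter_insert, if_neg fun h => htest.2 h h1]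
        exact hinv₂.2.1
    · intro s' h _
      refine ⟨fun c hc => ?_, h.2.2⟩
      rcases Nat.lt_succ_iff_lt_or_eq.1 hc with hc | rfl
      · exact h.1 c hc
      · rw [h.2.1, codeWeight]
  · intro s' h _
    exact h.1

theorem halts_bundleBound {s : Memory} {k : ℕ} (hn : s 0 0 0 = n) (hk : s 0 0 1 = k) :
    Halts bundleBound s 1000 (fun s' => s' 13 0 0 = (min n k : ℕ)) := by
  refine Halts.ite (T := 900) (by decide) (fun h1 => Halts.of_den (by decide) (by decide) ?_)
    (fun h1 => Halts.of_den (by decide) (by decide) ?_)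
  · simp only [Expr.eval, hn, hk, ne_eq, ite_eq_right_iff, one_ne_zero, imp_false,
      not_not] at h1
    simp only [Program.den, Expr.eval, Memory.set_same, hn]
    simp; omega
  · simp only [Expr.eval, hn, hk, ite_eq_right_iff, one_ne_zero, imp_false] at h1
    simp only [Program.den, Expr.eval, Memory.set_same, hk]
    simp; omega

theorem Prepared.splitsExpr {s : Memory} (h : Prepared G s) {c b c' : ℕ}
    (hc : c < numCodes n) (hb : b < numCodes n) (hc' : c' < numCodes n) (h15 : s 15 0 0 = c)
    (h16 : s 16 0 0 = b) (h17 : s 17 0 0 = c') :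
    splitsExpr.eval s ≠ 0 ↔ Splits G c b c' := by
  have e15 : (Expr.var 15).eval s = c := by simpa [Expr.eval, Expr.var] using h15
  have e17 : (Expr.var 17).eval s = c' := by simpa [Expr.eval, Expr.var] using h17
  have eb1 : (fstItem (.var 16)).eval s = ((b / (n + 2) : ℕ) : ℤ) := by
    simpa [Expr.eval, Expr.var, fstItem, h16] using h.fst b hb
  have eb2 : (sndItem (.var 16)).eval s = ((b % (n + 2) : ℕ) : ℤ) := by
    simpa [Expr.eval, Expr.var, sndItem, h16] using h.snd b hb
  have ec1 : (fstItem (.var 17)).eval s = ((c' / (n + 2) : ℕ) : ℤ) := by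
    simpa [Expr.eval, Expr.var, fstItem, h17] using h.fst c' hc'
  have ec2 : (sndItem (.var 17)).eval s = ((c' % (n + 2) : ℕ) : ℤ) := by
    simpa [Expr.eval, Expr.var, sndItem, h17] using h.snd c' hc'
  have d1 := h.domExpr hc (fst_lt hb) e15 eb1
  have d2 := h.domExpr hc (snd_lt b) e15 eb2
  have d3 := h.domExpr hc (fst_lt hc') e15 ec1
  have d4 := h.domExpr hc (snd_lt c') e15 ec2
  have d5 := h.domExpr hc' (fst_lt hb) e17 eb1
  have d6 := h.domExpr hc' (snd_lt b) e17 eb2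
  unfold Splits
  rw [← d1.2, ← d2.2, ← d3.2, ← d4.2, ← d5.2, ← d6.2]
  have p1 := d1.1
  have p2 := d2.1
  have p3 := d3.1
  have p4 := d4.1
  have p5 := d5.1
  have p6 := d6.1
  rw [CGMinSum.splitsExpr]
  simp only [Expr.eval.eq_5, Expr.eval.eq_3, Expr.eval.eq_1]
  split_ifs <;> omega

/-- While cell `(m + 1, i)` is under construction, all earlier entries are complete and this one is
optimal among the choices lexicographically before the current `(j, l)`. -/
theorem halts_table {s : Memory} {K : ℕ} (h : Prepared G s)
    (hW : ∀ c < numCodes n, s 7 c 0 = codeWeight G c) (hK : s 13 0 0 = K)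
    (h8 : ∀ c : ℕ, s 8 0 c = 0) :
    Halts table s (12 + K * ((12 + numCodes n * ((1000 + (12 + numCodes n *
      ((12 + numCodes n * (1000 + 16)) + 16))) + 16)) + 16)) (fun s' =>
      (∀ c : ℕ, s' 8 0 c = 0) ∧ ∀ m < K, ∀ c < numCodes n,
        Entry G (s' 8) (s' 9) (s' 10) (s' 11) (fun _ _ => True) m c) := by
  refine Halts.mono (Halts.count (N := K) (fun m s' => (∀ c : ℕ, s' 8 0 c = 0) ∧
    ∀ m' < m, ∀ c < numCodes n, Entry G (s' 8) (s' 9) (s' 10) (s' 11) (fun _ _ => True) m' c)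
    (by decide) (by decide) hK ?_ ?_ ?_) le_rfl (fun s' h _ => h)
  · intro i s' v h
    simpa [Memory.set_of_ne] using h
  · exact ⟨h8, by simp⟩
  intro m hm s₁ hf₁ hv₁ hinv₁
  have hp₁ : Prepared G s₁ := h.congr (hf₁ 0 (by decide)) (hf₁ 1 (by decide))
    (hf₁ 12 (by decide)) (hf₁ 5 (by decide)) (hf₁ 6 (by decide))
  refine Halts.mono (Halts.count (N := numCodes n) (fun i s' => (∀ c : ℕ, s' 8 0 c = 0) ∧
    ∀ m' c, c < numCodes n → (m' < m ∨ m' = m ∧ c < i) →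
      Entry G (s' 8) (s' 9) (s' 10) (s' 11) (fun _ _ => True) m' c)
    (by decide) (by decide) hp₁.num ?_ ?_ ?_) le_rfl ?_
  · intro i s' v h
    simpa [Memory.set_of_ne] using h
  · exact ⟨hinv₁.1, fun m' c hc h => hinv₁.2 m' (by omega) c hc⟩
  · intro i hi s₂ hf₂ hv₂ hinv₂
    have hm₂ : s₂ 14 0 0 = m := by rw [hf₂ 14 (by decide), hv₁]
    have hp₂ : Prepared G s₂ := hp₁.congr (hf₂ 0 (by decide)) (hf₂ 1 (by decide))
      (hf₂ 12 (by decide)) (hf₂ 5 (by decide)) (hf₂ 6 (by decide))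
    refine Halts.seq (R := fun s' => ((∀ c : ℕ, s' 8 0 c = 0) ∧
      ∀ m' c, c < numCodes n → (m' < m ∨ m' = m ∧ c < i) →
        Entry G (s' 8) (s' 9) (s' 10) (s' 11) (fun _ _ => True) m' c) ∧
      Entry G (s' 8) (s' 9) (s' 10) (s' 11) (fun _ _ => False) m i) ?_ ?_
    · refine Halts.of_den (by decide) (by decide) ⟨⟨fun c => ?_, fun m' c hc h => ?_⟩, ?_⟩
      · simp [initEntry, nextRow, Program.den, Expr.eval, Expr.var, Memory.set_of_ne,
          Memory.set_same, hinv₂.1]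
      · refine (hinv₂.2 m' c hc h).congr (m₀ := m) (c₀ := i) ?_ ?_ ?_ ?_ (by omega) <;>
        · intro x y hxy
          simp only [initEntry, nextRow, Program.den, Expr.eval, Expr.var, ne_eq,
            Nat.reduceEqDiff, not_false_eq_true, Memory.set_of_ne,
            Memory.set_same, hm₂, hv₂]
          rw [if_neg (by omega)]
      · refine ⟨?_, fun _ _ _ _ h => h.elim, Or.inl ⟨?_, ?_, ?_, ?_⟩⟩ <;>
          simp [initEntry, nextRow, Program.den, Expr.eval, Expr.var, Memory.set_of_ne,
            Memory.set_same, hm₂, hv₂, hp₂.size]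
    intro s₃ hinv₃ hf₃
    have hp₃ : Prepared G s₃ := hp₂.congr (hf₃ 0 (by decide)) (hf₃ 1 (by decide))
      (hf₃ 12 (by decide)) (hf₃ 5 (by decide)) (hf₃ 6 (by decide))
    have hm₃ : s₃ 14 0 0 = m := by rw [hf₃ 14 (by decide), hm₂]
    have hi₃ : s₃ 15 0 0 = i := by rw [hf₃ 15 (by decide), hv₂]
    have hW₃ : s₃ 7 = s 7 := by rw [hf₃ 7 (by decide), hf₂ 7 (by decide), hf₁ 7 (by decide)]
    refine Halts.mono (Halts.count (N := numCodes n) (fun j s' => ((∀ c : ℕ, s' 8 0 c = 0) ∧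
      ∀ m' c, c < numCodes n → (m' < m ∨ m' = m ∧ c < i) →
        Entry G (s' 8) (s' 9) (s' 10) (s' 11) (fun _ _ => True) m' c) ∧
      Entry G (s' 8) (s' 9) (s' 10) (s' 11) (fun b _ => b < j) m i)
      (by decide) (by decide) hp₃.num ?_ ?_ ?_) le_rfl ?_
    · intro i s' v h
      simpa [Memory.set_of_ne] using h
    · exact ⟨hinv₃.1, hinv₃.2.mono (by simp)⟩
    · intro j hj s₄ hf₄ hv₄ hinv₄
      have hp₄ : Prepared G s₄ := hp₃.congr (hf₄ 0 (by decide)) (hf₄ 1 (by decide))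
        (hf₄ 12 (by decide)) (hf₄ 5 (by decide)) (hf₄ 6 (by decide))
      refine Halts.mono (Halts.count (N := numCodes n) (fun l s' => ((∀ c : ℕ, s' 8 0 c = 0) ∧
        ∀ m' c, c < numCodes n → (m' < m ∨ m' = m ∧ c < i) →
          Entry G (s' 8) (s' 9) (s' 10) (s' 11) (fun _ _ => True) m' c) ∧
        Entry G (s' 8) (s' 9) (s' 10) (s' 11) (fun b c' => b < j ∨ (b = j ∧ c' < l)) m i)
        (by decide) (by decide) hp₄.num ?_ ?_ ?_) le_rfl ?_
      · intro i s' v h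
        simpa [Memory.set_of_ne] using h
      · exact ⟨hinv₄.1, hinv₄.2.mono (by simp)⟩
      · intro l hl s₅ hf₅ hv₅ hinv₅
        have hp₅ : Prepared G s₅ := hp₄.congr (hf₅ 0 (by decide)) (hf₅ 1 (by decide))
          (hf₅ 12 (by decide)) (hf₅ 5 (by decide)) (hf₅ 6 (by decide))
        have hm₅ : s₅ 14 0 0 = m := by rw [hf₅ 14 (by decide), hf₄ 14 (by decide), hm₃]
        have hi₅ : s₅ 15 0 0 = i := by rw [hf₅ 15 (by decide), hf₄ 15 (by decide), hi₃]
        have hj₅ : s₅ 16 0 0 = j := by rw [hf₅ 16 (by decide), hv₄]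
        have hW₅ : s₅ 7 j 0 = codeWeight G j := by
          rw [hf₅ 7 (by decide), hf₄ 7 (by decide), hW₃, hW j hj]
        have htest := hp₅.splitsExpr hi hj hl hi₅ hj₅ hv₅
        have hskip : (Splits G i j l → s₅ 8 m l + codeWeight G j ≤ s₅ 8 (m + 1) i) →
            Entry G (s₅ 8) (s₅ 9) (s₅ 10) (s₅ 11)
              (fun b c' => b < j ∨ (b = j ∧ c' < l + 1)) m i := by
          intro hle
          refine ⟨hinv₅.2.1, fun b hb c' hc' hd hs => ?_, hinv₅.2.2.2⟩
          by_cases hbc : b = j ∧ c' = l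
          · obtain ⟨rfl, rfl⟩ := hbc
            exact hle hs
          · exact hinv₅.2.2.1 b hb c' hc' (by omega) hs
        refine Halts.ite (T := 800) (by decide) (fun h1 => Halts.ite (T := 400) (by decide)
          (fun h2 => Halts.of_den (by decide) (by decide) ?_)
          (fun h2 => Halts.of_den (by decide) (by decide) ⟨hinv₅.1, hskip fun _ => ?_⟩))
          (fun h1 => Halts.of_den (by decide) (by decide) ⟨hinv₅.1, hskip fun hs => ?_⟩)
        · simp only [candidate, nextRow, Expr.eval, Expr.var, hm₅, hi₅, hj₅, hv₅, hW₅, ne_eq,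
            ite_eq_right_iff, one_ne_zero, imp_false, not_not] at h2
          have hs := htest.1 h1
          have hj1 := hp₅.fst j hj
          have hj2 := hp₅.snd j hj
          refine ⟨⟨fun c => ?_, fun m' c hc h => ?_⟩, ?_⟩
          · simp only [candidate, nextRow, fstItem, sndItem, Program.den, Expr.eval, Expr.var,
              ne_eq, Nat.reduceEqDiff, not_false_eq_true, Memory.set_of_ne,
              Memory.set_same, hm₅]
            rw [if_neg (by omega)]
            exact hinv₅.1.1 c
          · refine (hinv₅.1.2 m' c hc h).congr (m₀ := m) (c₀ := i) ?_ ?_ ?_ ?_ (by omega) <;>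
            · intro x y hxy
              simp only [candidate, nextRow, fstItem, sndItem, Program.den, Expr.eval, Expr.var,
                ne_eq, Nat.reduceEqDiff, not_false_eq_true,
                Memory.set_of_ne, Memory.set_same, hm₅, hi₅]
              rw [if_neg (by omega)]
          · have h5 := hinv₅.2.1
            have hold := hinv₅.2.2.1
            unfold Entry
            simp only [candidate, nextRow, fstItem, sndItem, Program.den, Expr.eval, Expr.var,
                ne_eq, Nat.reduceEqDiff, not_false_eq_true,
                Memory.set_of_ne, Memory.set_same, hm₅, hi₅, hj₅, hv₅, hW₅, hj1, hj2, and_self,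
                if_true]
            -- The update is in row `m + 1`, so the values read from row `m` are unchanged.
            have hrow : ∀ c' : ℕ, ¬ ((m : ℤ) = m + 1 ∧ (c' : ℤ) = i) := fun c' => by omega
            simp only [hrow, if_false]
            refine ⟨by omega, fun b hb c' hc' hd hs' => ?_,
              Or.inr ⟨j, hj, l, hl, hs, rfl, rfl, rfl, rfl⟩⟩
            by_cases hbc : b = j ∧ c' = l
            · rw [hbc.1, hbc.2]
            · exact (hold b hb c' hc' (by omega) hs').trans h2.le
        · simp only [candidate, nextRow, Expr.eval, Expr.var, hm₅, hi₅, hj₅, hv₅, hW₅,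
            ite_eq_right_iff, one_ne_zero, imp_false, not_lt] at h2
          exact h2
        · exact absurd h1 (htest.2 hs)
      · intro s' h _
        exact ⟨h.1, h.2.mono (by intros; omega)⟩
    · intro s' h _
      refine ⟨h.1.1, fun m' c hc hmc => ?_⟩
      by_cases hmc' : m' = m ∧ c = i
      · obtain ⟨rfl, rfl⟩ := hmc'
        exact h.2.mono (fun b hb _ _ _ => hb)
      · exact h.1.2 m' c hc (by omega)
  · intro s' h _
    exact ⟨h.1, fun m' hm' c hc => h.2 m' c hc (by omega)⟩

end Table

/-! ### Correctness of the traversal and of the answer -/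

section Traversal

variable {n : ℕ} {G : Digraph (Fin n)}

theorem NatDom.lt_left {x y : ℕ} (h : NatDom G x y) : x < n := h.1

theorem NatDom.lt_right {x y : ℕ} (h : NatDom G x y) : y < n := h.2.1

theorem ExtDom.trans {x y z : ℕ} (h : ExtDom G x y) (h' : ExtDom G y z) (hz : z < n) :
    ExtDom G x z := by
  rcases h' with h' | h' | h'
  · omega
  · rcases h with h | h | h
    · omega
    · omega
    · have := h.lt_right
      omega
  · have := h'.lt_left
    rcases h with h | h | h
    · omega
    · exact Or.inr (Or.inl ⟨h.1, hz⟩)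
    · exact Or.inr (Or.inr (h.trans h'))

theorem CodeDom.trans {c x y : ℕ} (h : CodeDom G c x) (h' : ExtDom G x y) (hy : y < n) :
    CodeDom G c y :=
  h.imp (fun h => h.trans h' hy) (fun h => h.trans h' hy)

theorem ExtDom.iff_natDom {x y : ℕ} (hx : x < n) (hy : y < n) : ExtDom G x y ↔ NatDom G x y := by
  constructor
  · rintro (h | h | h)
    · omega
    · omega
    · exact h
  · exact fun h => Or.inr (Or.inr h)

theorem ExtDom.iff_dominates (u v : Fin n) : ExtDom G u v ↔ Dominates G u v := by
  rw [ExtDom.iff_natDom u.2 v.2]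
  exact ⟨fun ⟨_, _, h⟩ => h, fun h => ⟨u.2, v.2, h⟩⟩

variable (G) in
/-- `v` is dominated by `u`. -/
abbrev DominatedBy (v u : Fin n) : Prop := Dominates G u v

theorem codeWeight_eq {b : ℕ} {p q : Fin n} (hp : b / (n + 2) = p) (hq : b % (n + 2) = q) :
    codeWeight G b = (below (DominatedBy G) {p, q}).card := by
  classical
  rw [codeWeight, ← Finset.card_map Fin.valEmbedding]
  congr 1
  ext u
  simp only [Finset.mem_filter, Finset.mem_range, Finset.mem_map, mem_below, Finset.mem_insert,
    Finset.mem_singleton, Fin.valEmbedding_apply]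
  constructor
  · rintro ⟨hu, h⟩
    refine ⟨⟨u, hu⟩, ?_, rfl⟩
    rcases h with h | h
    · rw [hp] at h
      exact ⟨p, Or.inl rfl, (ExtDom.iff_dominates p ⟨u, hu⟩).1 h⟩
    · rw [hq] at h
      exact ⟨q, Or.inr rfl, (ExtDom.iff_dominates q ⟨u, hu⟩).1 h⟩
  · rintro ⟨v, ⟨w, hw, h⟩, rfl⟩
    refine ⟨v.2, ?_⟩
    rcases hw with rfl | rfl
    · exact Or.inl (hp ▸ (ExtDom.iff_dominates _ _).2 h)
    · exact Or.inr (hq ▸ (ExtDom.iff_dominates _ _).2 h)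

theorem ExtDom.le {x y : ℕ} (h : ExtDom G x y) : y ≤ n := by
  rcases h with h | h | h
  · exact h.le
  · exact h.2.le
  · exact h.lt_right.le

/-- Nothing dominates the top, so items dominated by `c` are at most `n`; everything dominates the
bottom, so items not dominated by `c'` differ from `n`. -/
theorem Splits.lt {c b c' : ℕ} (h : Splits G c b c') : b / (n + 2) < n ∧ b % (n + 2) < n := by
  obtain ⟨h1, h2, -, -, h5, h6⟩ := h
  have key : ∀ x, CodeDom G c x → ¬ CodeDom G c' x → x < n := fun x h h' =>
    lt_of_le_of_ne (h.elim ExtDom.le ExtDom.le) fun hx => h' (Or.inl (Or.inl hx))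
  exact ⟨key _ h1 h5, key _ h2 h6⟩

theorem Splits.subset {c b c' u : ℕ} (h : Splits G c b c') (hu : u < n) (h' : CodeDom G c' u) :
    CodeDom G c u := by
  rcases h' with h' | h'
  · exact h.2.2.1.trans h' hu
  · exact h.2.2.2.1.trans h' hu

/-- The total number of items dominated by the classes of a labeling. -/
noncomputable def labelValue (G : Digraph (Fin n)) (k : ℕ) (L : Fin n → ℕ) : ℕ :=
  ∑ i : Fin k, (below (DominatedBy G) (Finset.univ.filter fun v => L v = i + 1)).card

/-- One step of the traversal. -/
theorem Entry.traverse {F BP BQ C : ℤ → ℤ → ℤ} {m c K k : ℕ} {M : ℤ} {L : Fin n → ℕ}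
    (h : Entry G F BP BQ C (fun _ _ => True) m c) (hc : c < numCodes n) (hm : m < K) (hK : K ≤ k)
    (hF : 0 ≤ F m c) (hL : ∀ v : Fin n, CodeDom G c v → L v = 0)
    (hL' : ∀ v, L v ≠ 0 → m + 1 < L v ∧ L v ≤ K) (hM : M ≤ F (m + 1) c + labelValue G k L) :
    ∃ c' < numCodes n, C (m + 1) c = c' ∧ ∃ L' : Fin n → ℕ,
      (∀ v : Fin n, L' v =
        if (v : ℤ) = BP (m + 1) c ∨ (v : ℤ) = BQ (m + 1) c then m + 1 else L v) ∧
      (∀ v : Fin n, CodeDom G c' v → L' v = 0) ∧ (∀ v, L' v ≠ 0 → m < L' v ∧ L' v ≤ K) ∧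
      M ≤ F m c' + labelValue G k L' := by
  classical
  obtain ⟨-, -, ⟨h1, h2, h3, h4⟩ | ⟨b, hb, c', hc', hs, h1, h2, h3, h4⟩⟩ := h
  -- A default entry has value 0, at most `F m c`, so passing to the previous row without labeling
  -- loses nothing.
  · refine ⟨c, hc, h4, L, fun v => ?_, hL, fun v hv => ?_, by omega⟩
    · rw [h2, h3, if_neg]
      have := v.2
      omega
    · have := hL' v hv
      omega
  · obtain ⟨hp, hq⟩ := hs.lt
    obtain ⟨p, hp⟩ : ∃ p : Fin n, b / (n + 2) = p := ⟨⟨_, hp⟩, rfl⟩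
    obtain ⟨q, hq⟩ : ∃ q : Fin n, b % (n + 2) = q := ⟨⟨_, hq⟩, rfl⟩
    have hcond : ∀ v : Fin n, ((v : ℤ) = BP (m + 1) c ∨ (v : ℤ) = BQ (m + 1) c) ↔
        v = p ∨ v = q := by
      intro v
      rw [h2, h3, hp, hq, Nat.cast_inj, Nat.cast_inj, Fin.val_inj, Fin.val_inj]
    have hLpq : ∀ v, v = p ∨ v = q → L v = 0 := by
      rintro v (rfl | rfl)
      · exact hL _ (hp ▸ hs.1)
      · exact hL _ (hq ▸ hs.2.1)
    refine ⟨c', hc', h4, fun v => if v = p ∨ v = q then m + 1 else L v, fun v => ?_,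
      fun v hv => ?_, fun v hv => ?_, ?_⟩
    · simp only [hcond]
    · have hnot : ¬ (v = p ∨ v = q) := by
        rintro (rfl | rfl)
        · exact hs.2.2.2.2.1 (hp ▸ hv)
        · exact hs.2.2.2.2.2 (hq ▸ hv)
      simp only [hnot, if_false]
      exact hL v (hs.subset v.2 hv)
    · by_cases hvpq : v = p ∨ v = q
      · simp only [hvpq, if_true]
        omega
      · simp only [hvpq, if_false] at hv ⊢
        have := hL' v hv
        omega
    · have hw := codeWeight_eq (G := G) hp hq
      -- The class of label `m + 1` was empty and becomes `{p, q}`. The other classes keep their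
      -- items, as `p` and `q` were unlabeled.
      have hle : labelValue G k L + codeWeight G b ≤
          labelValue G k (fun v => if v = p ∨ v = q then m + 1 else L v) := by
        have e : codeWeight G b = ∑ i : Fin k,
            if i = (⟨m, by omega⟩ : Fin k) then codeWeight G b else 0 := by
          simp
        rw [labelValue, labelValue, e, ← Finset.sum_add_distrib]
        refine Finset.sum_le_sum fun i _ => ?_
        by_cases hi : i = (⟨m, by omega⟩ : Fin k)
        · subst hi
          have e1 : (Finset.univ.filter fun v => L v = m + 1) = ∅ := by
            refine Finset.filter_eq_empty_iff.2 fun v _ hv => ?_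
            have := hL' v (by omega)
            omega
          have e2 : (Finset.univ.filter fun v =>
              (if v = p ∨ v = q then m + 1 else L v) = m + 1) = {p, q} := by
            ext v
            simp only [Finset.mem_filter, Finset.mem_univ, true_and, Finset.mem_insert,
              Finset.mem_singleton]
            by_cases hv : v = p ∨ v = q
            · simp [hv]
            · simp only [hv, if_false, iff_false]
              intro hv'
              have := hL' v (by omega)
              omega
          have e3 : below (DominatedBy G) ∅ = ∅ := by
            ext v
            simp [mem_below]
          simp only [if_true, e1, e2, e3, hw, Finset.card_empty, zero_add, le_refl]
        · have hi' : (i : ℕ) ≠ m := fun h => hi (Fin.ext h)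
          simp only [hi, if_false, add_zero]
          refine le_of_eq (congrArg (fun S => (below (DominatedBy G) S).card) ?_)
          ext v
          simp only [Finset.mem_filter, Finset.mem_univ, true_and]
          by_cases hv : v = p ∨ v = q
          · simp only [hLpq v hv, hv, if_true]
            omega
          · simp only [hv, if_false]
      have : (labelValue G k L : ℤ) + codeWeight G b ≤
          labelValue G k (fun v => if v = p ∨ v = q then m + 1 else L v) := by exact_mod_cast hle
      omega

/-- The sum of the table value at the current state and the coverage of the current labeling never
drops below the initial table value. Items of the current state are unlabeled, which keeps the
classes disjoint; in row 0 the table contributes nothing. -/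
theorem halts_traverse {s : Memory} {K k : ℕ} (hK : s 13 0 0 = K) (hk : K ≤ k)
    (h12 : s 12 0 0 = numCodes n) (h3 : ∀ v : ℕ, s 3 v 0 = 0) (h8 : ∀ c : ℕ, s 8 0 c = 0)
    (hE : ∀ m < K, ∀ c < numCodes n,
      Entry G (s 8) (s 9) (s 10) (s 11) (fun _ _ => True) m c) :
    Halts traverse s (1000 + (12 + K * (1000 + 16))) (fun s' => ∃ L : Fin n → ℕ,
      (∀ v : Fin n, s' 3 v 0 = L v) ∧ (∀ v, L v ≤ K) ∧
      s 8 K (numCodes n - 1 : ℕ) ≤ labelValue G k L) := by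
  have hpos : 0 < numCodes n := Nat.mul_pos (by omega) (by omega)
  have hnonneg : ∀ m ≤ K, ∀ c < numCodes n, 0 ≤ s 8 m c := by
    intro m hm c hc
    rcases m with _ | m
    · exact (h8 c).ge
    · exact_mod_cast (hE m hm c hc).1
  refine Halts.seq (R := fun s' => s' 18 0 0 = (numCodes n - 1 : ℕ)) ?_ ?_
  · refine Halts.of_den (by decide) (by decide) ?_
    simp [Program.den, Expr.eval, Expr.var, Memory.set_same, h12, Nat.cast_sub hpos]
  intro s₁ h18 hf₁
  refine Halts.mono (Halts.count (N := K) (fun j s' => ∃ c < numCodes n, s' 18 0 0 = c ∧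
    ∃ L : Fin n → ℕ, (∀ v : Fin n, s' 3 v 0 = L v) ∧ (∀ v : Fin n, CodeDom G c v → L v = 0) ∧
      (∀ v, L v ≠ 0 → K - j < L v ∧ L v ≤ K) ∧
      s 8 K (numCodes n - 1 : ℕ) ≤ s 8 (K - j : ℕ) c + labelValue G k L)
    (by decide) (by decide) (by rw [hf₁ 13 (by decide), hK]) ?_ ?_ ?_) le_rfl ?_
  · intro i s' v h
    simpa [Memory.set_of_ne] using h
  · refine ⟨numCodes n - 1, by omega, h18, fun _ => 0, fun v => ?_, fun _ _ => rfl,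
      fun v hv => absurd rfl hv, ?_⟩
    · rw [hf₁ 3 (by decide), h3]; rfl
    · simp
  · intro j hj s₂ hf₂ hv₂ hinv₂
    obtain ⟨c, hc, h18, L, hL3, hL, hL', hM⟩ := hinv₂
    obtain ⟨m, hm⟩ : ∃ m, K - j = m + 1 := ⟨K - j - 1, by omega⟩
    have hm' : K - (j + 1) = m := by omega
    rw [hm] at hL' hM
    push_cast at hM
    obtain ⟨c', hc', hC, L', hL'', h1, h2, h3⟩ := (hE m (by omega) c hc).traverse hc (by omega)
      hk (hnonneg m (by omega) c hc) hL hL' hM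
    have hrow : (K : ℤ) - j = m + 1 := by omega
    have hK₂ : s₂ 13 0 0 = K := by rw [hf₂ 13 (by decide), hf₁ 13 (by decide), hK]
    have e9 : s₂ 9 = s 9 := by rw [hf₂ 9 (by decide), hf₁ 9 (by decide)]
    have e10 : s₂ 10 = s 10 := by rw [hf₂ 10 (by decide), hf₁ 10 (by decide)]
    have e11 : s₂ 11 = s 11 := by rw [hf₂ 11 (by decide), hf₁ 11 (by decide)]
    refine Halts.of_den (by decide) (by decide) ⟨c', hc', ?_, L', fun v => ?_, h1, ?_, ?_⟩
    · simp [traceRow, Program.den, Expr.eval, Expr.var, Memory.set_of_ne, Memory.set_same, hK₂,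
        hv₂, h18, hrow, e11, hC]
    · simp only [traceRow, Program.den, Expr.eval, Expr.var, ne_eq, Nat.reduceEqDiff,
        not_false_eq_true, Memory.set_of_ne, Memory.set_same, hK₂,
        hv₂, h18, hrow, e9, e10, hL'' v, hL3, and_true]
      split_ifs <;> first | rfl | omega
    · rw [hm']; exact h2
    · rw [hm']; exact h3
  · rintro s' ⟨c, hc, -, L, hL3, -, hL', hM⟩ _
    refine ⟨L, hL3, fun v => ?_, ?_⟩
    · by_cases hv : L v = 0
      · omega
      · exact (hL' v hv).2
    · rw [Nat.sub_self, Nat.cast_zero, h8, zero_add] at hM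
      exact hM

theorem halts_answer {s : Memory} {K k : ℕ} {d : ℤ} (hn : s 0 0 0 = n) (hk : s 0 0 1 = k)
    (hd : s 0 0 2 = d) (hK : s 13 0 0 = K) (h12 : s 12 0 0 = numCodes n) (h19 : s 19 0 0 = 0) :
    Halts answer s ((12 + n * (1000 + 16)) + 1000) (fun s' => s' 2 0 0 =
      if d < n * k - s 8 K (numCodes n - 1 : ℕ) then 0 else 1) := by
  have hpos : 0 < numCodes n := Nat.mul_pos (by omega) (by omega)
  refine Halts.seq (R := fun s' => s' 19 0 0 = n * k) ?_ ?_
  · refine Halts.mono (Halts.count (N := n) (fun i s' => s' 19 0 0 = i * k)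
      (by decide) (by decide) hn ?_ ?_ ?_) le_rfl (fun s' h _ => h)
    · intro i s' v h
      simpa [Memory.set_of_ne] using h
    · simpa using h19
    · intro i hi s' hf hv hinv
      refine Halts.of_den (by decide) (by decide) ?_
      simp [Program.den, Expr.eval, Expr.var, Memory.set_same, hinv, hf 0 (by decide), hk]
      ring
  · intro s' h19' hf
    refine Halts.of_den (by decide) (by decide) ?_
    have hpos' : ((numCodes n - 1 : ℕ) : ℤ) = numCodes n - 1 := by
      rw [Nat.cast_sub hpos, Nat.cast_one]
    rw [hpos']
    simp only [Program.den, Expr.eval, Expr.var, Memory.set_same, h19', hf 0 (by decide),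
      hf 8 (by decide), hf 12 (by decide), hf 13 (by decide), hd, hK, h12]
    split_ifs <;> simp_all

end Traversal

/-! ### Optimality -/

section Optimality

variable {n : ℕ} {G : Digraph (Fin n)}

theorem dominates_antisymm {V : Type*} {G : Digraph V} (hG : Acyclic G) {u v : V}
    (h : Dominates G u v) (h' : Dominates G v u) : u = v := by
  rcases Relation.reflTransGen_iff_eq_or_transGen.1 h with h | h
  · exact h.symm
  · exact absurd (h.trans_left h') (hG u)

theorem comparable_of_width_le_two {V : Type*} [Fintype V] {G : Digraph V} (hw : width G ≤ 2)
    (x y z : V) : Dominates G y x ∨ Dominates G x y ∨ Dominates G z x ∨ Dominates G x z ∨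
      Dominates G z y ∨ Dominates G y z := by
  classical
  by_contra! hcon
  obtain ⟨h1, h2, h3, h4, h5, h6⟩ := hcon
  have hxy : x ≠ y := fun h => h1 (h ▸ .refl)
  have hxz : x ≠ z := fun h => h3 (h ▸ .refl)
  have hyz : y ≠ z := fun h => h5 (h ▸ .refl)
  have hanti : IsAntichain (Dominates G) (({x, y, z} : Finset V) : Set V) := by
    intro a ha b hb _
    simp only [Finset.coe_insert, Finset.coe_singleton, Set.mem_insert_iff,
      Set.mem_singleton_iff] at ha hb
    rcases ha with rfl | rfl | rfl <;> rcases hb with rfl | rfl | rfl <;>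
      first | assumption | contradiction
  have hle : ({x, y, z} : Finset V).card ≤ width G := by
    unfold width
    exact Finset.le_sup (f := Finset.card)
      (Finset.mem_filter.2 ⟨Finset.mem_univ _, hanti⟩)
  rw [Finset.card_eq_three.2 ⟨x, y, z, hxy, hxz, hyz, rfl⟩] at hle
  omega

/-- The code of a pair of extended items. -/
def code (n p q : ℕ) : ℕ := p * (n + 2) + q

theorem code_div {p q : ℕ} (hq : q < n + 2) : code n p q / (n + 2) = p := by
  rw [code, mul_comm, Nat.mul_add_div (by omega), Nat.div_eq_of_lt hq, add_zero]

theorem code_mod {p q : ℕ} (hq : q < n + 2) : code n p q % (n + 2) = q := by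
  rw [code, mul_comm, Nat.mul_add_mod, Nat.mod_eq_of_lt hq]

theorem code_lt {p q : ℕ} (hp : p < n + 2) (hq : q < n + 2) : code n p q < numCodes n := by
  unfold code numCodes
  nlinarith

/-- The last code is the pair of two top items, the state that contains all items. -/
theorem numCodes_sub_one : numCodes n - 1 = code n (n + 1) (n + 1) := by
  unfold code numCodes
  have : (n + 2) * (n + 2) = (n + 1) * (n + 2) + (n + 1) + 1 := by ring
  omega

/-- The table bounds the number of items dominated by the bundles of any allocation. -/
theorem sum_card_below_bundle_le (hG : Acyclic G) (hw : width G ≤ 2) {k : ℕ}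
    {F BP BQ C : ℤ → ℤ → ℤ} (h0 : ∀ c : ℕ, F 0 c = 0)
    (hE : ∀ m < min n k, ∀ c < numCodes n, Entry G F BP BQ C (fun _ _ => True) m c)
    (π : Allocation (Fin n) k) :
    ((∑ i, (below (DominatedBy G) (π.bundle i)).card : ℕ) : ℤ) ≤
      F (min n k : ℕ) (numCodes n - 1 : ℕ) := by
  classical
  have hcode : ∀ p q, p < n + 2 → q < n + 2 → ∃ c : Fin (numCodes n), (c : ℕ) / (n + 2) = p ∧
      (c : ℕ) % (n + 2) = q := fun p q hp hq =>
    ⟨⟨code n p q, code_lt hp hq⟩, code_div hq, code_mod hq⟩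
  set I : Finset (Fin k) := Finset.univ.filter fun i => (π.bundle i).Nonempty with hI
  have hdisj : ∀ i ∈ I, ∀ j ∈ I, i ≠ j → Disjoint (π.bundle i) (π.bundle j) :=
    fun i _ j _ hij => π.disjoint i j hij
  -- Disjoint nonempty bundles number at most `n`, which is why `min n k` rows are enough.
  have hcard : I.card ≤ min n k := by
    refine le_min ?_ ?_
    · calc I.card = ∑ i ∈ I, 1 := by simp
        _ ≤ ∑ i ∈ I, (π.bundle i).card :=
          Finset.sum_le_sum fun i hi => Finset.card_pos.2 (Finset.mem_filter.1 hi).2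
        _ = (I.biUnion π.bundle).card := (Finset.card_biUnion hdisj).symm
        _ ≤ n := by simpa using Finset.card_le_univ (I.biUnion π.bundle)
    · simpa using Finset.card_le_univ I
  have hsum : ∑ i, (below (DominatedBy G) (π.bundle i)).card =
      ∑ i ∈ I, (below (DominatedBy G) (π.bundle i)).card := by
    symm
    refine Finset.sum_subset (Finset.subset_univ _) fun i _ hi => ?_
    have : π.bundle i = ∅ := by simpa [hI] using hi
    rw [this, Finset.card_eq_zero, Finset.eq_empty_iff_forall_notMem]
    simp [mem_below]
  have hpos : 0 < numCodes n := Nat.mul_pos (by omega) (by omega)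
  have hdom : ∀ c (v : Fin n), c / (n + 2) = n + 1 → CodeDom G c v := fun c v hc =>
    Or.inl (Or.inr (Or.inl ⟨hc, v.2⟩))
  rw [hsum]
  refine sum_card_below_le (le := DominatedBy G) (σ := Fin (numCodes n))
    (mem := fun c v => CodeDom G c v) (f := fun m c => F m c) (K := min n k)
    (fun _ => .refl) (fun _ _ _ h h' => h'.trans h) (fun _ _ h h' => dominates_antisymm hG h' h)
    (comparable_of_width_le_two hw) ?_ ?_ ?_ ?_ ?_ le_rfl ⟨numCodes n - 1, by omega⟩ I π.bundle
    hcard ?_ hdisj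
  · exact fun c x y h h' => h.trans ((ExtDom.iff_dominates x y).2 h') y.2
  · intro p q
    obtain ⟨c, h1, h2⟩ := hcode p q (by omega) (by omega)
    refine ⟨c, fun x => ?_⟩
    rw [CodeDom, h1, h2, ExtDom.iff_dominates, ExtDom.iff_dominates]
  · obtain ⟨c, h1, h2⟩ := hcode n n (by omega) (by omega)
    have hno : ∀ v : Fin n, ¬ ExtDom G n v := by
      rintro v (h | h | h)
      · omega
      · omega
      · exact absurd h.lt_left (lt_irrefl _)
    refine ⟨c, fun x hx => ?_⟩
    rw [CodeDom, h1, h2] at hx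
    exact hx.elim (hno x) (hno x)
  · intro m hm c p q c' hp hq hsub hp' hq'
    obtain ⟨b, h1, h2⟩ := hcode p q (by omega) (by omega)
    have hentry := (hE m hm c c.2).2.1 b b.2 c' c'.2 trivial
    rw [codeWeight_eq h1 h2] at hentry
    -- Inclusion of states is known for genuine items only. The bottom is dominated by every state,
    -- and the top cannot occur in `c'`, since `c'` would then dominate `p`.
    have key : ∀ x < n + 2, (x = n + 1 → CodeDom G c' p) → (x < n → CodeDom G c' x) →
        CodeDom G c x := by
      intro x hx hx1 hx2
      obtain hx | rfl | rfl : x < n ∨ x = n ∨ x = n + 1 := by omega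
      · exact hsub ⟨x, hx⟩ (hx2 hx)
      · exact Or.inl (Or.inl rfl)
      · exact absurd (hx1 rfl) hp'
    have hrefl : ∀ x < n, ExtDom G x x := fun x hx =>
      (ExtDom.iff_natDom hx hx).2 (NatDom.refl hx)
    have := hentry ⟨h1 ▸ hp, h2 ▸ hq,
      key _ (fst_lt c'.2) (fun h => Or.inl (Or.inr (Or.inl ⟨h, p.2⟩)))
        (fun h => Or.inl (hrefl _ h)),
      key _ (snd_lt _) (fun h => Or.inr (Or.inr (Or.inl ⟨h, p.2⟩)))
        (fun h => Or.inr (hrefl _ h)), h1 ▸ hp', h2 ▸ hq'⟩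
    push_cast
    linarith
  · intro m hm c
    rcases m with _ | m
    · exact (h0 c).ge
    · exact_mod_cast (hE m hm c c.2).1
  · intro i _ x _
    refine hdom _ x ?_
    show (numCodes n - 1) / (n + 2) = n + 1
    rw [numCodes_sub_one, code_div (by omega)]

theorem totalDissatisfaction_eq {k : ℕ} (π : Allocation (Fin n) k) :
    (totalDissatisfaction G π : ℤ) =
      n * k - (∑ i, (below (DominatedBy G) (π.bundle i)).card : ℕ) := by
  classical
  have h : ∀ i, dissatisfaction G π i + (below (DominatedBy G) (π.bundle i)).card = n := by
    intro i
    rw [add_comm, dissatisfaction, below]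
    convert Finset.card_filter_add_card_filter_not (s := (Finset.univ : Finset (Fin n)))
      (fun v => ∃ u ∈ π.bundle i, Dominates G u v)
    simp
  have hs : totalDissatisfaction G π + ∑ i, (below (DominatedBy G) (π.bundle i)).card =
      n * k := by
    rw [totalDissatisfaction, ← Finset.sum_add_distrib, Finset.sum_congr rfl fun i _ => h i]
    simp [mul_comm]
  rw [eq_sub_iff_add_eq]
  exact_mod_cast hs

/-- The allocation given by a labeling. -/
def Allocation.ofLabels (k : ℕ) (L : Fin n → ℕ) : Allocation (Fin n) k where
  bundle i := Finset.univ.filter fun v => L v = i + 1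
  disjoint i j hij := by
    rw [Finset.disjoint_left]
    intro v hv hv'
    simp only [Finset.mem_filter, Finset.mem_univ, true_and] at hv hv'
    exact hij (Fin.ext (by omega))

/-- The number of steps of the program on `n` items. -/
def steps (n : ℕ) : ℕ :=
  (12 + n * (1000 + 16)) + ((12 + n * ((12 + n * ((12 + n * (1000 + 16)) + 16)) + 16)) +
    (((12 + n * (1000 + 16)) + 1000) + ((12 + (n + 2) * ((12 + (n + 2) * (1000 + 16)) + 16)) +
      ((12 + numCodes n * ((12 + n * (1000 + 16)) + 16)) + (1000 +
        ((12 + n * ((12 + numCodes n * ((1000 + (12 + numCodes n *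
          ((12 + numCodes n * (1000 + 16)) + 16))) + 16)) + 16)) +
            ((1000 + (12 + n * (1000 + 16))) + ((12 + n * (1000 + 16)) + 1000))))))))

theorem exists_polynomial_steps : ∃ p : Polynomial ℕ, ∀ n, p.eval n = steps n := by
  open Polynomial in
  refine ⟨(12 + X * (1000 + 16)) + ((12 + X * ((12 + X * ((12 + X * (1000 + 16)) + 16)) + 16)) +
    (((12 + X * (1000 + 16)) + 1000) + ((12 + (X + 2) * ((12 + (X + 2) * (1000 + 16)) + 16)) +
      ((12 + ((X + 2) * (X + 2)) * ((12 + X * (1000 + 16)) + 16)) + (1000 +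
        ((12 + X * ((12 + ((X + 2) * (X + 2)) * ((1000 + (12 + ((X + 2) * (X + 2)) *
          ((12 + ((X + 2) * (X + 2)) * (1000 + 16)) + 16))) + 16)) + 16)) +
            ((1000 + (12 + X * (1000 + 16))) + ((12 + X * (1000 + 16)) + 1000)))))))), fun n => ?_⟩
  simp only [Polynomial.eval_add, Polynomial.eval_mul, Polynomial.eval_X, Polynomial.eval_ofNat,
    steps, numCodes]

/-- This collects what the run itself guarantees: correct table entries, a labeling that attains at
least the table value, and the comparison with `d`. The width enters only when the table is compared
with arbitrary allocations. -/
theorem halts_solver (I : Problem) :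
    Halts solver I.input (steps I.n) (fun s => ∃ F BP BQ C : ℤ → ℤ → ℤ, (∀ c : ℕ, F 0 c = 0) ∧
      (∀ m < min I.n I.k, ∀ c < numCodes I.n, Entry I.G F BP BQ C (fun _ _ => True) m c) ∧
      (∃ L : Fin I.n → ℕ, (∀ v : Fin I.n, s 3 v 0 = L v) ∧ (∀ v, L v ≤ min I.n I.k) ∧
        F (min I.n I.k : ℕ) (numCodes I.n - 1 : ℕ) ≤ labelValue I.G I.k L) ∧
      s 2 0 0 = if I.d < I.n * I.k - F (min I.n I.k : ℕ) (numCodes I.n - 1 : ℕ) then 0 else 1) := by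
  classical
  have zn : I.input 0 0 0 = I.n := by simp [Problem.input]
  have zk : I.input 0 0 1 = I.k := by simp [Problem.input]
  have zd : I.input 0 0 2 = I.d := by simp [Problem.input]
  have zA : ∀ x < I.n, ∀ y < I.n, I.input 1 x y = if NatAdj I.G x y then 1 else 0 := by
    intro x hx y hy
    simp only [Problem.input, one_ne_zero, false_and, if_false, true_and]
    refine if_congr ?_ rfl rfl
    constructor
    · rintro ⟨u, v, hu, hv, h⟩
      rw [Nat.cast_inj] at hu hv
      subst hu hv
      exact ⟨u.2, v.2, h⟩
    · rintro ⟨hx, hy, h⟩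
      exact ⟨⟨x, hx⟩, ⟨y, hy⟩, rfl, rfl, h⟩
  have z : ∀ a i j, 2 ≤ a → I.input a i j = 0 := by
    intro a i j ha
    have h0 : a ≠ 0 := by omega
    have h1 : a ≠ 1 := by omega
    simp [Problem.input, h0, h1]
  unfold solver steps
  refine Halts.seq (halts_diagonal (G := I.G) zn zA) fun s₁ h₁ f₁ => ?_
  have n₁ : s₁ 0 0 0 = I.n := by rw [f₁ 0 (by decide), zn]
  refine Halts.seq (halts_closure n₁ h₁) fun s₂ h₂ f₂ => ?_
  have n₂ : s₂ 0 0 0 = I.n := by rw [f₂ 0 (by decide), n₁]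
  refine Halts.seq (halts_border n₂ h₂) fun s₃ h₃ f₃ => ?_
  -- Several later phases rely on arrays that are still in their initial all-zero state.
  have F₃ : ∀ a, a ≠ 1 → a ≠ 4 → a < 14 ∨ 17 < a → s₃ a = I.input a := by
    intro a h1 h4 ha
    rw [f₃ a, f₂ a, f₁ a]
    all_goals
      simp [diagonal, closure, border, Program.count, Program.writes]
      omega
  refine Halts.seq (halts_codes h₃.2 ?_) fun s₄ h₄ f₄ => ?_
  · rw [F₃ 12 (by decide) (by decide) (by decide)]
    exact z 12 _ _ (by decide)
  have p₄ : Prepared I.G s₄ := by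
    refine ⟨?_, ?_, h₄.1, fun c hc => (h₄.2 c hc).1, fun c hc => (h₄.2 c hc).2⟩
    · rw [f₄ 0 (by decide), F₃ 0 (by decide) (by decide) (by decide), zn]
    · rw [f₄ 1 (by decide)]
      exact h₃.1
  refine Halts.seq (halts_weights p₄ fun c => ?_) fun s₅ h₅ f₅ => ?_
  · rw [f₄ 7 (by decide), F₃ 7 (by decide) (by decide) (by decide)]
    exact z 7 _ _ (by decide)
  have p₅ : Prepared I.G s₅ := p₄.congr (f₅ 0 (by decide)) (f₅ 1 (by decide)) (f₅ 12 (by decide))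
    (f₅ 5 (by decide)) (f₅ 6 (by decide))
  refine Halts.seq (halts_bundleBound p₅.size (k := I.k) ?_) fun s₆ h₆ f₆ => ?_
  · rw [f₅ 0 (by decide), f₄ 0 (by decide), F₃ 0 (by decide) (by decide) (by decide), zk]
  have p₆ : Prepared I.G s₆ := p₅.congr (f₆ 0 (by decide)) (f₆ 1 (by decide)) (f₆ 12 (by decide))
    (f₆ 5 (by decide)) (f₆ 6 (by decide))
  have F₆ : ∀ a, a ≠ 1 → a ≠ 4 → a ≠ 5 → a ≠ 6 → a ≠ 7 → a ≠ 12 → a ≠ 13 → a < 14 ∨ 17 < a →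
      s₆ a = I.input a := by
    intro a h1 h4 h5 h6 h7 h12 h13 ha
    rw [f₆ a, f₅ a, f₄ a, F₃ a h1 h4 ha]
    all_goals
      simp [codes, weights, bundleBound, Program.count, Program.writes]
      omega
  refine Halts.seq (T := 12 + I.n * ((12 + numCodes I.n * ((1000 + (12 + numCodes I.n *
      ((12 + numCodes I.n * (1000 + 16)) + 16))) + 16)) + 16))
    (Halts.mono (halts_table p₆ (fun c hc => ?_) h₆ fun c => ?_) ?_ fun s' h _ => h)
    fun s₇ h₇ f₇ => ?_
  · rw [f₆ 7 (by decide)]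
    exact h₅ c hc
  · rw [F₆ 8] <;> first | decide | exact z 8 _ _ (by decide)
  -- The table has `min n k` rows; bounding this by `n` removes `k` from the running time.
  · gcongr
    exact min_le_left _ _
  have F₇ : ∀ a, a = 0 ∨ a = 2 ∨ a = 3 ∨ a = 19 → s₇ a = I.input a := by
    intro a ha
    rw [f₇ a, F₆ a]
    all_goals first
      | omega
      | (simp [table, initEntry, improve, Program.count, Program.writes]; omega)
  have b₇ : s₇ 13 0 0 = (min I.n I.k : ℕ) := by rw [f₇ 13 (by decide), h₆]
  have c₇ : s₇ 12 0 0 = numCodes I.n := by rw [f₇ 12 (by decide), p₆.num]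
  refine Halts.seq (T := 1000 + (12 + I.n * (1000 + 16)))
    (Halts.mono (halts_traverse (k := I.k) b₇ (min_le_right _ _) c₇ (fun v => ?_) h₇.1 h₇.2)
      ?_ fun s' h _ => h) fun s₈ h₈ f₈ => ?_
  · rw [F₇ 3 (by decide)]
    exact z 3 _ _ (by decide)
  · gcongr
    exact min_le_left _ _
  refine Halts.mono (halts_answer (n := I.n) (k := I.k) (d := I.d) (K := min I.n I.k)
    ?_ ?_ ?_ ?_ ?_ ?_) le_rfl fun s₉ h₉ f₉ => ?_
  · rw [f₈ 0 (by decide), F₇ 0 (by decide), zn]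
  · rw [f₈ 0 (by decide), F₇ 0 (by decide), zk]
  · rw [f₈ 0 (by decide), F₇ 0 (by decide), zd]
  · rw [f₈ 13 (by decide), b₇]
  · rw [f₈ 12 (by decide), c₇]
  · rw [f₈ 19 (by decide), F₇ 19 (by decide)]
    exact z 19 _ _ (by decide)
  · rw [f₈ 8 (by decide)] at h₉
    obtain ⟨L, hL, hL', hM⟩ := h₈
    refine ⟨s₇ 8, s₇ 9, s₇ 10, s₇ 11, h₇.1, h₇.2, ⟨L, fun v => ?_, hL', hM⟩, h₉⟩
    rw [f₉ 3 (by decide), hL]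

end Optimality

end CGMinSum

/-! ### Optimality of the labeling and correctness of the answer -/

theorem theorem3p5 :
    ∃ (P : CGMinSum.Program) (p : Polynomial ℕ),
      ∀ I : CGMinSum.Problem, CGMinSum.width I.G ≤ 2 →
        ∃ (t : ℕ) (s : CGMinSum.Memory),
          CGMinSum.Run P I.input t s ∧
          t ≤ p.eval I.n ∧
          I.AnswerIn s ∧
          ∃ π : CGMinSum.Allocation (Fin I.n) I.k,
            CGMinSum.IsOptimal I.G π ∧ I.LabelingIn π s := by
  obtain ⟨p, hp⟩ := CGMinSum.exists_polynomial_steps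
  refine ⟨CGMinSum.solver, p, fun I hw => ?_⟩
  obtain ⟨t, s, hrun, ht, F, BP, BQ, C, h0, hE, ⟨L, hL, hLK, hM⟩, hans⟩ :=
    CGMinSum.halts_solver I
  have hle := CGMinSum.sum_card_below_bundle_le I.acyclic hw h0 hE
  have htot := CGMinSum.totalDissatisfaction_eq (G := I.G) (k := I.k)
  set π := CGMinSum.Allocation.ofLabels I.k L with hπ
  have hval : F (min I.n I.k : ℕ) (CGMinSum.numCodes I.n - 1 : ℕ) ≤
      ((∑ i, (CGMinSum.below (CGMinSum.DominatedBy I.G) (π.bundle i)).card : ℕ) : ℤ) := hM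
  have hopt : CGMinSum.IsOptimal I.G π := by
    intro π'
    have h1 := htot π
    have h2 := htot π'
    have h3 := hle π'
    omega
  refine ⟨t, s, hrun, (hp I.n).symm ▸ ht, ?_, π, hopt, fun v => ?_⟩
  -- The table value is both attained and an upper bound, so the tested quantity is exactly the
  -- minimum total dissatisfaction.
  · have hF := le_antisymm hval (hle π)
    rw [hF, ← htot π] at hans
    by_cases hd : I.d < CGMinSum.totalDissatisfaction I.G π
    · rw [if_pos hd] at hans
      refine Or.inr ⟨?_, hans⟩
      rintro ⟨π', hπ'⟩
      have := hopt π'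
      omega
    · rw [if_neg hd] at hans
      exact Or.inl ⟨⟨π, not_lt.1 hd⟩, hans⟩
  · rw [hL v]
    by_cases hv : L v = 0
    · refine Or.inr ⟨fun i hi => ?_, by rw [hv]; rfl⟩
      have := (Finset.mem_filter.1 hi).2
      omega
    · have hk := (hLK v).trans (min_le_right _ _)
      refine Or.inl ⟨⟨L v - 1, by omega⟩, Finset.mem_filter.2 ⟨Finset.mem_univ _, ?_⟩, ?_⟩
      · simp only
        omega
      · simp only
        omega
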